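/- Let $K$ be a field of characteristic $0$, let $N\in\mathbb N_{\ge 2}\cup\{\omega\}$, and let $X$ be a set. Let $A=K\{X\}_N$ be the free unitary $\mathrm{Mag}_N$-algebra on $X$. That is, $A$ is the $K$-vector space with basis the empty tree $1$ together with the planar reduced rooted trees whose leaves are labelled by $X$ and whose inner vertices have arity at most $N$ (no bound if $N=\omega$). Its operations are the multilinear grafting operations $\vee^k$, $2\le k\le N$, where empty arguments are deleted: $\vee^k(\dots,1,\dots)=\vee^{k-1}(\dots,\dots)$ for $k\ge 3$, $\vee^2(1,a)=\vee^2(a,1)=a$, and $\vee^k(1,\dots,1)=1$. Let $A\otimes A$ carry the component-wise operations $\vee^k(a_1\otimes b_1,\dots,a_k\otimes b_k)=\vee^k(a_1,\dots,a_k)\otimes\vee^k(b_1,\dots,b_k)$, and let $\Delta_a:A\to A\otimes A$ be the co-addition, i.e. the linear map compatible with all $\vee^k$ such that $\Delta_a(1)=1\otimes 1$ and $\Delta_a(x)=x\otimes 1+1\otimes x$ for $x\in X$. Let $\varepsilon:A\to K$ be the augmentation (the coefficient of $1$), and let $\operatorname{Prim}A=\{f\in A:\Delta_a(f)=f\otimes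 1+1\otimes f\}$. Then $(A,\Delta_a,\varepsilon)$, coaugmented by $1$, is a coassociative, counital, cocommutative coalgebra. It is conilpotent: every $a\in\ker\varepsilon$ is annihilated by some iterate of the reduced comultiplication $a\mapsto\Delta_a(a)-a\otimes 1-1\otimes a$. It is cofree, co-generated by its primitive elements: there are linear maps $\pi:A\to\operatorname{Prim}A$ with $\pi(1)=0$ and $\pi|_{\operatorname{Prim}A}=\mathrm{id}$, and for every such $\pi$, every conilpotent cocommutative (coassociative, counital) coalgebra $B$ over $K$ coaugmented by a group-like element $b$, and every linear map $f:B\to\operatorname{Prim}A$ with $f(b)=0$, there is a unique coalgebra morphism $F:B\to A$ with $F(b)=1$ and $\pi\circ F=f$. -/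

import Mathlib

open scoped TensorProduct

universe u v w

/-! ### Planar reduced trees and the free unitary `Mag_N`-algebra -/

/-- Planar reduced rooted trees whose leaves are labelled by `X` and all of whose inner vertices
have arity between `2` and `N`; here `N = ⊤` plays the role of `ω` (no upper bound). -/
inductive MagTree (N : ℕ∞) (X : Type v) : Type v
  | leaf (x : X) : MagTree N X
  | node (k : ℕ) (hk : 2 ≤ k) (hkN : (k : ℕ∞) ≤ N) (c : Fin k → MagTree N X) : MagTree N X

namespace MagTree

variable {N : ℕ∞} {X : Type v}

/-- Grafting a list of nonempty trees, with the conventions for lists of length `0` and `1`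
dictated by the unit action: the empty list gives the empty tree `none`, a single tree is not
changed, and `m ≥ 2` trees are grafted to a new root of arity `m`. -/
def graftList : (l : List (MagTree N X)) → (l.length : ℕ∞) ≤ N → Option (MagTree N X)
  | [], _ => none
  | [t], _ => some t
  | t :: t' :: l, h =>
      some (node (t :: t' :: l).length (by simp) h (t :: t' :: l).get)

theorem length_reduceOption_ofFn_le {k : ℕ} (hk : (k : ℕ∞) ≤ N)
    (s : Fin k → Option (MagTree N X)) :
    ((List.ofFn s).reduceOption.length : ℕ∞) ≤ N :=
  le_trans (by
    have := List.reduceOption_length_le (List.ofFn s)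
    rw [List.length_ofFn] at this
    exact_mod_cast this) hk

/-- The operation `∨ᵏ` on possibly empty trees (`none` is the empty tree, that is, the unit `1`):
the empty trees are deleted, and the remaining ones are grafted. So
`∨ᵏ(…, 1, …) = ∨ᵏ⁻¹(…, …)`, `∨²(1, t) = ∨²(t, 1) = t` and `∨ᵏ(1, …, 1) = 1`. -/
def graft {k : ℕ} (hk : (k : ℕ∞) ≤ N) (s : Fin k → Option (MagTree N X)) :
    Option (MagTree N X) :=
  graftList (List.ofFn s).reduceOption (length_reduceOption_ofFn_le hk s)

theorem graftList_congr {l l' : List (MagTree N X)} (e : l = l') (h : (l.length : ℕ∞) ≤ N)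
    (h' : (l'.length : ℕ∞) ≤ N) : graftList l h = graftList l' h' := by
  subst e; rfl

theorem graft_insertNth_none {k : ℕ} (hk' : ((k + 1 : ℕ) : ℕ∞) ≤ N) (hk : (k : ℕ∞) ≤ N)
    (i : Fin (k + 1)) (s : Fin k → Option (MagTree N X)) :
    graft hk' (i.insertNth (α := fun _ => Option (MagTree N X)) none s) = graft hk s := by
  refine graftList_congr ?_ _ _
  clear hk hk'
  induction k with
  | zero =>
    obtain rfl : i = 0 := Fin.fin_one_eq_zero i
    simp [Fin.insertNth_zero', List.reduceOption_cons_of_none]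
  | succ k ih =>
    refine Fin.cases ?_ (fun j => ?_) i
    · rw [Fin.insertNth_zero', List.ofFn_cons, List.reduceOption_cons_of_none]
    · rw [← Fin.cons_self_tail s, Fin.insertNth_succ_cons, List.ofFn_cons, List.ofFn_cons]
      have := ih j (Fin.tail s)
      cases s 0 with
      | none => simpa [List.reduceOption_cons_of_none] using this
      | some t => simpa [List.reduceOption_cons_of_some] using this

theorem graftList_of_two_le (l : List (MagTree N X)) (h2 : 2 ≤ l.length)
    (h : (l.length : ℕ∞) ≤ N) : graftList l h = some (node l.length h2 h l.get) := by
  match l, h2, h with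
  | _ :: _ :: _, _, _ => rfl

theorem reduceOption_ofFn_some {k : ℕ} (c : Fin k → MagTree N X) :
    (List.ofFn fun i => some (c i)).reduceOption = List.ofFn c := by
  induction k with
  | zero => rfl
  | succ k ih =>
    rw [List.ofFn_succ, List.reduceOption_cons_of_some, ih, List.ofFn_succ]

theorem graft_some_of_two_le {k : ℕ} (h2 : 2 ≤ k) (hk : (k : ℕ∞) ≤ N) (c : Fin k → MagTree N X) :
    graft hk (fun i => some (c i)) = some (node k h2 hk c) := by
  have key : ∀ (l : List (MagTree N X)) (m : ℕ) (h : l.length = m) (h2 : 2 ≤ m)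
      (hl : (m : ℕ∞) ≤ N) (hl' : (l.length : ℕ∞) ≤ N),
      graftList l hl' = some (node m h2 hl fun i => l.get (i.cast h.symm)) := by
    intro l m h h2 hl hl'
    subst h
    exact graftList_of_two_le l h2 hl'
  unfold graft
  rw [graftList_congr (reduceOption_ofFn_some c) _ (by simpa using hk),
    key _ k (by simp) h2 hk]
  simp

end MagTree

/-- The free unitary `Mag_N`-algebra `K{X}_N`: the vector space with basis the possibly empty
planar reduced `X`-labelled trees with vertices of arity at most `N`. -/
def FreeMag (K : Type u) [Field K] (N : ℕ∞) (X : Type v) : Type (max u v) :=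
  Option (MagTree N X) →₀ K

namespace FreeMag

variable (K : Type u) [Field K] (N : ℕ∞) (X : Type v)

noncomputable instance : AddCommGroup (FreeMag K N X) :=
  inferInstanceAs (AddCommGroup (Option (MagTree N X) →₀ K))

noncomputable instance : Module K (FreeMag K N X) :=
  inferInstanceAs (Module K (Option (MagTree N X) →₀ K))

/-- The basis of possibly empty trees. -/
noncomputable def treeBasis : Module.Basis (Option (MagTree N X)) K (FreeMag K N X) :=
  Module.Basis.ofRepr (LinearEquiv.refl K (Option (MagTree N X) →₀ K))

/-- The basis of `A ⊗ A` given by pairs of possibly empty trees. -/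
noncomputable def treePairBasis :
    Module.Basis (Option (MagTree N X) × Option (MagTree N X)) K
      (FreeMag K N X ⊗[K] FreeMag K N X) :=
  (treeBasis K N X).tensorProduct (treeBasis K N X)

end FreeMag

open scoped Classical in
/-- The `K`-multilinear extension of a `k`-ary operation on a basis. -/
noncomputable def Module.Basis.multilinearExt {K M ι : Type*} [Field K] [AddCommGroup M]
    [Module K M] (b : Module.Basis ι K M) {k : ℕ} (g : (Fin k → ι) → ι) :
    MultilinearMap K (fun _ : Fin k => M) M :=
  ((b.repr.symm.toLinearMap ∘ₗ Finsupp.lmapDomain K K g ∘ₗ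
    (PiTensorProduct.ofFinsuppEquiv' (R := K) (κ := fun _ : Fin k => ι)).toLinearMap).compMultilinearMap (PiTensorProduct.tprod K)).compLinearMap fun _ => b.repr.toLinearMap

theorem Module.Basis.multilinearExt_apply {K M ι : Type*} [Field K] [AddCommGroup M]
    [Module K M] (b : Module.Basis ι K M) {k : ℕ} (g : (Fin k → ι) → ι) (s : Fin k → ι) :
    b.multilinearExt g (fun i => b (s i)) = b (g s) := by
  simp [Module.Basis.multilinearExt]

namespace FreeMag

variable {K : Type u} [Field K] {N : ℕ∞} {X : Type v}

/-- The unit `1`, that is, the empty tree. -/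
noncomputable instance : One (FreeMag K N X) := ⟨treeBasis K N X none⟩

/-- The generator of `K{X}_N` given by a variable `x`. -/
noncomputable def var (x : X) : FreeMag K N X := treeBasis K N X (some (MagTree.leaf x))

/-- The operation `∨ᵏ` on the free unitary `Mag_N`-algebra. -/
noncomputable def vee {k : ℕ} (hk : (k : ℕ∞) ≤ N) :
    MultilinearMap K (fun _ : Fin k => FreeMag K N X) (FreeMag K N X) :=
  (treeBasis K N X).multilinearExt (MagTree.graft hk)

/-- The operation `∨ᵏ` on `A ⊗ A`, which is defined component-wise,
see `veeTensor_tmul`. -/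
noncomputable def veeTensor {k : ℕ} (hk : (k : ℕ∞) ≤ N) :
    MultilinearMap K (fun _ : Fin k => FreeMag K N X ⊗[K] FreeMag K N X)
      (FreeMag K N X ⊗[K] FreeMag K N X) :=
  (treePairBasis K N X).multilinearExt fun s =>
    (MagTree.graft hk fun i => (s i).1, MagTree.graft hk fun i => (s i).2)

/-- The value of the co-addition on a nonempty tree, by recursion on the tree:
`x ↦ x ⊗ 1 + 1 ⊗ x`, and `∨ᵏ(t₁, …, tₖ) ↦ ∨ᵏ(Δ t₁, …, Δ tₖ)`. -/
noncomputable def coAddTree : MagTree N X → FreeMag K N X ⊗[K] FreeMag K N X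
  | .leaf x => var x ⊗ₜ[K] 1 + 1 ⊗ₜ[K] var x
  | .node _ _ hkN c => veeTensor hkN fun i => coAddTree (c i)

/-- The value of the co-addition on a possibly empty tree; `1 ↦ 1 ⊗ 1`. -/
noncomputable def coAddOption : Option (MagTree N X) → FreeMag K N X ⊗[K] FreeMag K N X
  | none => 1 ⊗ₜ[K] 1
  | some t => coAddTree t

variable (K N X) in
/-- The co-addition `Δₐ : A → A ⊗ A` on `A = K{X}_N`: the morphism of unitary `Mag_N`-algebras
with `Δₐ x = x ⊗ 1 + 1 ⊗ x` for all variables `x`, see `coAdd_one`, `coAdd_var`, `coAdd_vee`. -/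
noncomputable def coAdd : FreeMag K N X →ₗ[K] FreeMag K N X ⊗[K] FreeMag K N X :=
  (treeBasis K N X).constr K coAddOption

variable (K N X) in
/-- The augmentation `A = K 1 ⊕ Ā → K`: the coefficient of the empty tree. -/
noncomputable def augmentation : FreeMag K N X →ₗ[K] K :=
  (treeBasis K N X).coord none

theorem vee_treeBasis {k : ℕ} (hk : (k : ℕ∞) ≤ N) (s : Fin k → Option (MagTree N X)) :
    vee hk (fun i => treeBasis K N X (s i)) = treeBasis K N X (MagTree.graft hk s) :=
  Module.Basis.multilinearExt_apply _ _ _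

theorem veeTensor_treeBasis {k : ℕ} (hk : (k : ℕ∞) ≤ N) (s t : Fin k → Option (MagTree N X)) :
    veeTensor hk (fun i => treeBasis K N X (s i) ⊗ₜ[K] treeBasis K N X (t i)) =
      treeBasis K N X (MagTree.graft hk s) ⊗ₜ[K] treeBasis K N X (MagTree.graft hk t) := by
  have := Module.Basis.multilinearExt_apply (treePairBasis K N X)
    (fun s => (MagTree.graft hk fun i => (s i).1, MagTree.graft hk fun i => (s i).2))
    (fun i => (s i, t i))
  simpa [treePairBasis, veeTensor] using this

theorem veeTensor_tmul {k : ℕ} (hk : (k : ℕ∞) ≤ N) (a b : Fin k → FreeMag K N X) :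
    veeTensor hk (fun i => a i ⊗ₜ[K] b i) = vee hk a ⊗ₜ[K] vee hk b := by
  have h1 : ∀ s : Fin k → Option (MagTree N X),
      (veeTensor hk).compLinearMap
          (fun i => (TensorProduct.mk K _ (FreeMag K N X)) (treeBasis K N X (s i))) =
        (TensorProduct.mk K _ _ (vee hk fun i => treeBasis K N X (s i))).compMultilinearMap
          (vee hk) := by
    intro s
    refine Module.Basis.ext_multilinear (fun _ => treeBasis K N X) fun t => ?_
    simp [vee_treeBasis, veeTensor_treeBasis]
  have h2 : (veeTensor hk).compLinearMap
          (fun i => (TensorProduct.mk K (FreeMag K N X) (FreeMag K N X)).flip (b i)) =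
        ((TensorProduct.mk K _ _).flip (vee hk b)).compMultilinearMap (vee hk) := by
    refine Module.Basis.ext_multilinear (fun _ => treeBasis K N X) fun s => ?_
    simpa using congrArg (fun f => f b) (h1 s)
  simpa using congrArg (fun f => f a) h2

theorem coAdd_one : coAdd K N X 1 = 1 ⊗ₜ[K] 1 :=
  (treeBasis K N X).constr_basis K _ none

theorem coAdd_var (x : X) : coAdd K N X (var x) = var x ⊗ₜ[K] 1 + 1 ⊗ₜ[K] var x := by
  refine ((treeBasis K N X).constr_basis K _ _).trans ?_
  simp [coAddOption, coAddTree]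

theorem coAdd_treeBasis (t : Option (MagTree N X)) :
    coAdd K N X (treeBasis K N X t) = coAddOption t :=
  (treeBasis K N X).constr_basis K _ t

theorem veeTensor_insertNth_one {k : ℕ} (hk' : ((k + 1 : ℕ) : ℕ∞) ≤ N) (hk : (k : ℕ∞) ≤ N)
    (i : Fin (k + 1)) (a : Fin k → FreeMag K N X ⊗[K] FreeMag K N X) :
    veeTensor hk' (i.insertNth (α := fun _ => FreeMag K N X ⊗[K] FreeMag K N X) (1 ⊗ₜ 1) a) =
      veeTensor hk a := by
  have h : (veeTensor hk').curryMid i ((1 : FreeMag K N X) ⊗ₜ[K] (1 : FreeMag K N X)) =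
      veeTensor hk := by
    refine Module.Basis.ext_multilinear (fun _ => treePairBasis K N X) fun s => ?_
    have e : (i.insertNth (α := fun _ => FreeMag K N X ⊗[K] FreeMag K N X)
        ((1 : FreeMag K N X) ⊗ₜ[K] (1 : FreeMag K N X)) fun j => treePairBasis K N X (s j)) =
        fun j => treeBasis K N X
            (i.insertNth (α := fun _ => Option (MagTree N X)) none (fun j => (s j).1) j) ⊗ₜ[K]
          treeBasis K N X
            (i.insertNth (α := fun _ => Option (MagTree N X)) none (fun j => (s j).2) j) := by
      funext j
      refine Fin.succAboveCases i ?_ (fun j => ?_) j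
      · simp only [Fin.insertNth_apply_same]; rfl
      · simp [treePairBasis, Module.Basis.tensorProduct_apply']
    rw [MultilinearMap.curryMid_apply_apply, e, veeTensor_treeBasis,
      MagTree.graft_insertNth_none hk' hk, MagTree.graft_insertNth_none hk' hk,
      ← veeTensor_treeBasis hk]
    simp [treePairBasis, Module.Basis.tensorProduct_apply']
  simpa using congrArg (fun f => f a) h

theorem veeTensor_one_apply (hk : ((1 : ℕ) : ℕ∞) ≤ N)
    (a : Fin 1 → FreeMag K N X ⊗[K] FreeMag K N X) : veeTensor hk a = a 0 := by
  have h : veeTensor hk = (MultilinearMap.ofSubsingleton K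
      (FreeMag K N X ⊗[K] FreeMag K N X) (FreeMag K N X ⊗[K] FreeMag K N X) (0 : Fin 1))
        LinearMap.id := by
    refine Module.Basis.ext_multilinear (fun _ => treePairBasis K N X) fun s => ?_
    have g : ∀ f : Fin 1 → Option (MagTree N X), MagTree.graft hk f = f 0 := by
      intro f
      have hf : f = fun _ => f 0 := funext fun i => by rw [Fin.fin_one_eq_zero i]
      generalize f 0 = o at hf
      subst hf
      cases o <;> rfl
    have h2 := veeTensor_treeBasis (K := K) hk (fun i => (s i).1) fun i => (s i).2
    rw [g, g] at h2
    simpa [treePairBasis, Module.Basis.tensorProduct_apply'] using h2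
  rw [h]; rfl

theorem coAddOption_graft {k : ℕ} (hk : (k : ℕ∞) ≤ N) (s : Fin k → Option (MagTree N X)) :
    coAddOption (K := K) (MagTree.graft hk s) = veeTensor hk fun i => coAddOption (s i) := by
  induction k with
  | zero =>
    have h := veeTensor_treeBasis (K := K) hk s s
    have e : MagTree.graft hk s = none := rfl
    rw [e] at h
    rw [e]
    refine h.symm.trans ?_
    congr 1
    funext i
    exact i.elim0
  | succ k ih =>
    have hk' : (k : ℕ∞) ≤ N := le_trans (by exact_mod_cast Nat.le_succ k) hk
    by_cases hs : ∃ i, s i = none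
    · obtain ⟨i, hi⟩ := hs
      have e : s = i.insertNth (α := fun _ => Option (MagTree N X)) none (i.removeNth s) := by
        rw [← hi]; exact (Fin.insertNth_self_removeNth i s).symm
      have e' : (fun j => coAddOption (K := K) (s j)) =
          i.insertNth (α := fun _ => FreeMag K N X ⊗[K] FreeMag K N X) (1 ⊗ₜ 1)
            fun j => coAddOption (i.removeNth s j) := by
        funext j
        refine Fin.succAboveCases i ?_ (fun j => ?_) j
        · rw [hi, Fin.insertNth_apply_same]; rfl
        · rw [Fin.insertNth_apply_succAbove]; rfl
      rw [e', veeTensor_insertNth_one hk hk', ← ih hk', e, MagTree.graft_insertNth_none hk hk',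
        ← e]
    · push Not at hs
      have hs' : ∀ i, ∃ t, s i = some t := fun i => Option.ne_none_iff_exists'.1 (hs i)
      choose c hc using hs'
      obtain rfl : s = fun i => some (c i) := funext hc
      rcases Nat.lt_or_ge (k + 1) 2 with h | h
      · obtain rfl : k = 0 := by omega
        rw [veeTensor_one_apply]; rfl
      · rw [MagTree.graft_some_of_two_le h]
        simp [coAddOption, coAddTree]

theorem coAdd_vee {k : ℕ} (hk : (k : ℕ∞) ≤ N) (a : Fin k → FreeMag K N X) :
    coAdd K N X (vee hk a) = veeTensor hk fun i => coAdd K N X (a i) := by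
  have h : (coAdd K N X).compMultilinearMap (vee hk) =
      (veeTensor hk).compLinearMap fun _ => coAdd K N X := by
    refine Module.Basis.ext_multilinear (fun _ => treeBasis K N X) fun s => ?_
    simp [vee_treeBasis, coAdd_treeBasis, coAddOption_graft]
  simpa using congrArg (fun f => f a) h

end FreeMag

/-! ### Coaugmented coalgebras: primitive elements, conilpotence, cofreeness -/

section Coaugmented

variable (K : Type u) [Field K] {C : Type v} [AddCommGroup C] [Module K C] [Coalgebra K C]

/-- The space of primitive elements with respect to the coaugmentation (group-like element) `e`:
`Δ c = c ⊗ e + e ⊗ c`. -/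
def primitiveElements (e : C) : Submodule K C where
  carrier := {c | Coalgebra.comul (R := K) c = c ⊗ₜ[K] e + e ⊗ₜ[K] c}
  zero_mem' := by simp
  add_mem' {a b} ha hb := by
    simp only [Set.mem_ofPred_eq] at ha hb ⊢
    rw [map_add, ha, hb, TensorProduct.add_tmul, TensorProduct.tmul_add]; abel
  smul_mem' r a ha := by
    simp only [Set.mem_ofPred_eq] at ha ⊢
    rw [map_smul, ha, smul_add, TensorProduct.smul_tmul', TensorProduct.tmul_smul]

/-- The projection `c ↦ c - ε(c) e` of `C = K e ⊕ ker ε` onto `ker ε`. -/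
noncomputable def augProj (e : C) : C →ₗ[K] C :=
  LinearMap.id - (Coalgebra.counit (R := K) (A := C)).smulRight e

/-- The reduced comultiplication `Δ'`, extended by `Δ' e = 0`: it is
`c ↦ Δ c - c ⊗ e - e ⊗ c` on `ker ε`. -/
noncomputable def reducedComul (e : C) : C →ₗ[K] C ⊗[K] C :=
  (Coalgebra.comul - (TensorProduct.mk K C C).flip e - TensorProduct.mk K C C e) ∘ₗ augProj K e

/-- The iterated reduced comultiplication `C → C^{⊗ (n+1)}`: it is the identity for `n = 0`, and
`(Δ'ⁿ ⊗ id) ∘ Δ'` for `n + 1`. -/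
noncomputable def iteratedReducedComul (e : C) : (n : ℕ) → C →ₗ[K] ⨂[K]^(n + 1) C
  | 0 => (PiTensorProduct.subsingletonEquiv (R := K) (s := fun _ : Fin 1 => C) 0).symm.toLinearMap
  | n + 1 => TensorPower.mulEquiv.toLinearMap ∘ₗ
      TensorProduct.map (iteratedReducedComul e n)
        (PiTensorProduct.subsingletonEquiv (R := K) (s := fun _ : Fin 1 => C) 0).symm.toLinearMap ∘ₗ
      reducedComul K e

/-- The coalgebra `C`, coaugmented by `e`, is conilpotent: every element of the augmentation
coideal `ker ε` is annihilated by some iterate of the reduced comultiplication. -/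
def IsConilpotent (e : C) : Prop :=
  ∀ c : C, Coalgebra.counit (R := K) c = 0 → ∃ n : ℕ, iteratedReducedComul K e n c = 0

/-- The coalgebra `C`, coaugmented by `e`, together with the linear map `p : C → W` (vanishing on
`e`), has the universal property of the cofree conilpotent cocommutative coalgebra on `W`: every
linear map `f : B → W`, vanishing on the coaugmentation, from a conilpotent cocommutative coalgebra
`B` lifts uniquely to a morphism `B → C` of coaugmented coalgebras. -/
def IsCofreeCocommutative (e : C) {W : Type v} [AddCommGroup W] [Module K W] (p : C →ₗ[K] W) :
    Prop :=
  p e = 0 ∧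
  ∀ (B : Type w) [AddCommGroup B] [Module K B] [Coalgebra K B] [Coalgebra.IsCocomm K B] (b : B),
    IsGroupLikeElem K b → IsConilpotent K b → ∀ f : B →ₗ[K] W, f b = 0 →
      ∃! F : B →ₗc[K] C, F b = e ∧ ∀ x, p (F x) = f x

end Coaugmented

/-! Cofreeness needs only that `∨²` is a coalgebra morphism `μ : C ⊗ C → C` with two-sided unit `e`.
Linear maps `B → C` are convolved through `μ`. If `g` has primitive values and kills `b`, its
left-normed divided powers `g^[n]` satisfy `Δ g^[n] = ∑_{i+j=n} (g^[i] ⊗ g^[j]) Δ`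
(`comul_convDivPow`), even for nonassociative `μ`; cocommutativity of `B` makes convolution
compatible with `Δ`, and characteristic 0 allows division by `n`. On the step `S m` of the coradical
filtration every `g^[n]` with `n > m` vanishes, so `E g = ∑ g^[n]` is defined, and it is a coalgebra
morphism.

As `p` need not kill products, `p ∘ E g` may differ from `g`, and a lift of `f` is found by solving
`p ∘ E g = f`. On `S (m + 1)` the error `E g - g` depends only on `g` restricted to `S m`
(`convDivPow_congr`), so `g ↦ f - p ∘ (E g - g)` is contracting for the filtration, and iterating it
from `0` yields a fixed point. Uniqueness is `CoalgHom.eq_of_projection_eq`: if two lifts agree on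
`S m`, their difference has primitive values on `S (m + 1)`, where `p` is the identity.

For `K{X}_N`, the coalgebra identities compare maps compatible with all `∨ᵏ`, so they are checked on
`1` and the variables (`linearMap_ext`). Conilpotence holds because `Δₐ` preserves the number of
leaves. -/

/-! ### Coradical filtration and uniqueness of lifts -/

section Conilpotent

open Coalgebra TensorProduct

variable {K : Type u} [Field K] {B : Type w} [AddCommGroup B] [Module K B] [Coalgebra K B] {b : B}

theorem augProj_apply (b c : B) : augProj K b c = c - counit (R := K) c • b := rfl

theorem augProj_self (hb : IsGroupLikeElem K b) : augProj K b b = 0 := by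
  simp [augProj_apply, hb.counit_eq_one]

theorem counit_augProj (hb : IsGroupLikeElem K b) (c : B) :
    counit (R := K) (augProj K b c) = 0 := by
  simp [augProj_apply, hb.counit_eq_one]

theorem augProj_of_counit_eq_zero {c : B} (hc : counit (R := K) c = 0) :
    augProj K b c = c := by
  simp [augProj_apply, hc]

theorem augProj_augProj (hb : IsGroupLikeElem K b) (c : B) :
    augProj K b (augProj K b c) = augProj K b c :=
  augProj_of_counit_eq_zero (counit_augProj hb c)

theorem reducedComul_augProj (hb : IsGroupLikeElem K b) (c : B) :
    reducedComul K b (augProj K b c) = reducedComul K b c := by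
  simp [reducedComul, augProj_augProj hb]

theorem comul_augProj (b c : B) :
    comul (R := K) (augProj K b c) =
      reducedComul K b c + augProj K b c ⊗ₜ b + b ⊗ₜ augProj K b c := by
  simp only [reducedComul, LinearMap.comp_apply, LinearMap.sub_apply, LinearMap.flip_apply,
    TensorProduct.mk_apply]
  abel

theorem comm_reducedComul [IsCocomm K B] (b c : B) :
    TensorProduct.comm K B B (reducedComul K b c) = reducedComul K b c := by
  simp only [reducedComul, LinearMap.comp_apply, LinearMap.sub_apply, map_sub, comm_comul,
    LinearMap.flip_apply, TensorProduct.mk_apply, TensorProduct.comm_tmul]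
  abel

theorem LinearMap.exists_comp_eq_of_ker_le {U V W : Type*} [AddCommGroup U] [Module K U]
    [AddCommGroup V] [Module K V] [AddCommGroup W] [Module K W] (f : U →ₗ[K] V) (g : U →ₗ[K] W)
    (h : LinearMap.ker f ≤ LinearMap.ker g) : ∃ g' : V →ₗ[K] W, g' ∘ₗ f = g := by
  obtain ⟨s, hs⟩ := f.rangeRestrict.exists_rightInverse_of_surjective f.range_rangeRestrict
  obtain ⟨g', hg'⟩ := LinearMap.exists_extend (g ∘ₗ s)
  refine ⟨g', LinearMap.ext fun x => ?_⟩
  have h1 : g' (f x) = g (s (f.rangeRestrict x)) := LinearMap.congr_fun hg' (f.rangeRestrict x)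
  have h2 : f (s (f.rangeRestrict x)) = f x :=
    congrArg Subtype.val (LinearMap.congr_fun hs (f.rangeRestrict x))
  have h3 : s (f.rangeRestrict x) - x ∈ LinearMap.ker g := h (by simp [h2])
  rw [LinearMap.comp_apply, h1]
  simpa [sub_eq_zero] using h3

variable (K) in
/-- The coradical filtration of a coaugmented coalgebra, starting with the line spanned by the
coaugmentation. -/
noncomputable def coradicalFiltration (b : B) (m : ℕ) : Submodule K B :=
  LinearMap.ker (iteratedReducedComul K b m ∘ₗ augProj K b)

theorem mem_coradicalFiltration {m : ℕ} {c : B} :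
    c ∈ coradicalFiltration K b m ↔ iteratedReducedComul K b m (augProj K b c) = 0 := Iff.rfl

theorem mem_coradicalFiltration_zero {c : B} :
    c ∈ coradicalFiltration K b 0 ↔ augProj K b c = 0 := by
  rw [mem_coradicalFiltration, iteratedReducedComul, LinearEquiv.coe_coe,
    LinearEquiv.map_eq_zero_iff]

/-- The other factors in the recursion are isomorphisms. With this criterion, tensor powers can be
avoided from here on. -/
theorem iteratedReducedComul_succ_eq_zero {m : ℕ} {c : B} :
    iteratedReducedComul K b (m + 1) c = 0 ↔
      (iteratedReducedComul K b m).rTensor B (reducedComul K b c) = 0 := by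
  have : ∀ z, TensorProduct.map (iteratedReducedComul K b m)
      (PiTensorProduct.subsingletonEquiv (R := K) (s := fun _ : Fin 1 => B) 0).symm.toLinearMap z =
      (TensorProduct.congr (LinearEquiv.refl K _)
        (PiTensorProduct.subsingletonEquiv (R := K) (s := fun _ : Fin 1 => B) 0).symm)
        ((iteratedReducedComul K b m).rTensor B z) := by
    intro z
    rw [← LinearEquiv.coe_coe, ← LinearMap.comp_apply]
    congr 1
    ext
    simp
  simp only [iteratedReducedComul, LinearMap.comp_apply, LinearEquiv.coe_coe, this,
    LinearEquiv.map_eq_zero_iff]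

theorem ker_iteratedReducedComul_le (hb : IsGroupLikeElem K b) (m : ℕ) :
    LinearMap.ker (iteratedReducedComul K b m) ≤ coradicalFiltration K b m := by
  intro c hc
  cases m with
  | zero =>
    rw [mem_coradicalFiltration_zero]
    have : c = 0 := by simpa [iteratedReducedComul] using hc
    simp [this]
  | succ m =>
    rw [LinearMap.mem_ker, iteratedReducedComul_succ_eq_zero] at hc
    rw [mem_coradicalFiltration, iteratedReducedComul_succ_eq_zero, reducedComul_augProj hb, hc]

/-- A usable form of "`Δ'` sends step `m + 1` into step `m` tensor `B`": over a field `φ` factors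
through the `m`-th iterate of `Δ'`, so `φ ⊗ ψ` factors through a map that already kills `Δ' c`. -/
theorem map_reducedComul_eq_zero (hb : IsGroupLikeElem K b) {U V : Type*} [AddCommGroup U]
    [Module K U] [AddCommGroup V] [Module K V] {φ : B →ₗ[K] U} (ψ : B →ₗ[K] V) {m : ℕ}
    (hφ : ∀ c ∈ coradicalFiltration K b m, φ c = 0) {c : B}
    (hc : c ∈ coradicalFiltration K b (m + 1)) :
    TensorProduct.map φ ψ (reducedComul K b c) = 0 := by
  rw [mem_coradicalFiltration, iteratedReducedComul_succ_eq_zero, reducedComul_augProj hb] at hc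
  obtain ⟨φ', rfl⟩ := LinearMap.exists_comp_eq_of_ker_le (iteratedReducedComul K b m) φ
    fun c h => hφ c (ker_iteratedReducedComul_le hb m h)
  have : TensorProduct.map (φ' ∘ₗ iteratedReducedComul K b m) ψ =
      TensorProduct.map φ' ψ ∘ₗ (iteratedReducedComul K b m).rTensor B := by
    ext; simp
  rw [this, LinearMap.comp_apply, hc, map_zero]

theorem map_reducedComul_eq_zero' [IsCocomm K B] (hb : IsGroupLikeElem K b) {U V : Type*}
    [AddCommGroup U] [Module K U] [AddCommGroup V] [Module K V] {φ : B →ₗ[K] U} (ψ : B →ₗ[K] V)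
    {m : ℕ} (hφ : ∀ c ∈ coradicalFiltration K b m, φ c = 0) {c : B}
    (hc : c ∈ coradicalFiltration K b (m + 1)) :
    TensorProduct.map ψ φ (reducedComul K b c) = 0 := by
  rw [← comm_reducedComul, TensorProduct.map_comm, map_reducedComul_eq_zero hb ψ hφ hc, map_zero]

theorem coradicalFiltration_le_succ (hb : IsGroupLikeElem K b) (m : ℕ) :
    coradicalFiltration K b m ≤ coradicalFiltration K b (m + 1) := by
  intro c hc
  rw [mem_coradicalFiltration, iteratedReducedComul_succ_eq_zero, reducedComul_augProj hb]
  induction m generalizing c with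
  | zero =>
    rw [mem_coradicalFiltration_zero] at hc
    simp [reducedComul, hc]
  | succ m ih =>
    refine map_reducedComul_eq_zero hb LinearMap.id (fun c hc => ?_) hc
    have h := ih hc
    rwa [← iteratedReducedComul_succ_eq_zero] at h

theorem monotone_coradicalFiltration (hb : IsGroupLikeElem K b) :
    Monotone (coradicalFiltration K b) :=
  monotone_nat_of_le_succ (coradicalFiltration_le_succ hb)

theorem IsConilpotent.exists_mem_coradicalFiltration (hb : IsGroupLikeElem K b)
    (h : IsConilpotent K b) (c : B) : ∃ m, c ∈ coradicalFiltration K b m :=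
  h _ (counit_augProj hb c)

/-- The values `T n c` are constant once `c ∈ S n`, so the limit may be read off at any chosen level
containing `c`. Used both for the exponential series and for the fixed-point iteration. -/
theorem LinearMap.exists_eq_on_of_filtration {K B W : Type*} [Field K] [AddCommGroup B]
    [Module K B] [AddCommGroup W] [Module K W] {S : ℕ → Submodule K B} (hmono : Monotone S)
    (hS : ∀ c, ∃ m, c ∈ S m) (T : ℕ → B →ₗ[K] W)
    (hT : ∀ m, ∀ c ∈ S m, T (m + 1) c = T m c) :
    ∃ T' : B →ₗ[K] W, ∀ m, ∀ c ∈ S m, T' c = T m c := by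
  have hT' : ∀ {m n c}, m ≤ n → c ∈ S m → T n c = T m c := by
    intro m n c hmn hc
    induction n, hmn using Nat.le_induction with
    | base => rfl
    | succ n hn ih => rw [hT n c (hmono hn hc), ih]
  choose d hd using hS
  have key : ∀ {m c}, c ∈ S m → T (d c) c = T m c := fun {m c} hc => by
    rw [← hT' (le_max_left (d c) m) (hd c), ← hT' (le_max_right (d c) m) hc]
  refine ⟨⟨⟨fun c => T (d c) c, fun x y => ?_⟩, fun r x => ?_⟩, fun m c hc => key hc⟩
  · have hx := hmono (le_max_left (d x) (d y)) (hd x)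
    have hy := hmono (le_max_right (d x) (d y)) (hd y)
    rw [key hx, key hy, key (add_mem hx hy), map_add]
  · change T (d (r • x)) (r • x) = r • T (d x) x
    rw [key (Submodule.smul_mem _ r (hd x)), map_smul]

variable {C : Type v} [AddCommGroup C] [Module K C] [Coalgebra K C] {e : C}

theorem mem_primitiveElements {c : C} :
    c ∈ primitiveElements K e ↔ comul (R := K) c = c ⊗ₜ[K] e + e ⊗ₜ[K] c := Iff.rfl

/-- Applying `ε ⊗ id` to `Δ c` gives `ε(c) e + c = c`, and `e ≠ 0`. -/
theorem counit_eq_zero_of_mem_primitiveElements (he : IsGroupLikeElem K e) {c : C}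
    (hc : c ∈ primitiveElements K e) : counit (R := K) c = 0 := by
  have h := Coalgebra.rTensor_counit_comul (R := K) c
  rw [mem_primitiveElements.1 hc] at h
  have h2 := congrArg (TensorProduct.lid K C) h
  simp only [map_add, LinearMap.rTensor_tmul, TensorProduct.lid_tmul, he.counit_eq_one, one_smul,
    add_eq_right] at h2
  exact (smul_eq_zero.1 h2).resolve_right he.ne_zero

/-- A coalgebra morphism from a conilpotent coalgebra is determined by its composition with a
projection onto the primitive elements. -/
theorem CoalgHom.eq_of_projection_eq [IsCocomm K B] (hb : IsGroupLikeElem K b)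
    (hB : IsConilpotent K b) (p : C →ₗ[K] primitiveElements K e)
    (hp : ∀ c : primitiveElements K e, p c = c) {F G : B →ₗc[K] C} (hF : F b = e) (hG : G b = e)
    (hFG : ∀ x, p (F x) = p (G x)) : F = G := by
  set H : B →ₗ[K] C := (F : B →ₗ[K] C) - (G : B →ₗ[K] C) with hH
  have hHb : H b = 0 := by simp [hH, hF, hG]
  have hHc : ∀ c, H c = H (augProj K b c) := fun c => by simp [augProj_apply, hHb]
  have key : ∀ m, ∀ c ∈ coradicalFiltration K b m, H c = 0 := by
    intro m
    induction m with
    | zero =>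
      intro c hc
      rw [hHc, mem_coradicalFiltration_zero.1 hc, map_zero]
    | succ m ih =>
      intro c hc
      -- Telescoping: `F ⊗ F - G ⊗ G = H ⊗ F + G ⊗ H`. By induction both terms kill `Δ' c`, leaving
      -- only the boundary terms, which say that `H (augProj K b c)` is primitive.
      have h1 : TensorProduct.map (F : B →ₗ[K] C) (F : B →ₗ[K] C) =
          TensorProduct.map H (F : B →ₗ[K] C) + TensorProduct.map (G : B →ₗ[K] C) H +
            TensorProduct.map (G : B →ₗ[K] C) (G : B →ₗ[K] C) := by
        rw [hH]; ext; simp [TensorProduct.sub_tmul, TensorProduct.tmul_sub]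
      have h2 := map_reducedComul_eq_zero hb (F : B →ₗ[K] C) ih hc
      have h3 := map_reducedComul_eq_zero' hb (G : B →ₗ[K] C) ih hc
      have hprim : H (augProj K b c) ∈ primitiveElements K e := by
        rw [mem_primitiveElements]
        have hFc := CoalgHomClass.map_comp_comul_apply F (augProj K b c)
        have hGc := CoalgHomClass.map_comp_comul_apply G (augProj K b c)
        rw [h1, LinearMap.add_apply, hGc, LinearMap.add_apply, ← eq_sub_iff_add_eq,
          ← map_sub] at hFc
        have : H (augProj K b c) = F (augProj K b c) - G (augProj K b c) := rfl
        rw [this, ← hFc, comul_augProj, map_add, map_add, map_add, map_add, h2, h3, ← this]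
        simp [hHb, hF, hG]
      have h4 := hp ⟨_, hprim⟩
      have h5 : p (H (augProj K b c)) = 0 := by
        have : H (augProj K b c) = F (augProj K b c) - G (augProj K b c) := rfl
        rw [this, map_sub, hFG, sub_self]
      rw [hHc]
      rw [h5] at h4
      exact congrArg Subtype.val h4.symm
  refine CoalgHom.ext fun x => sub_eq_zero.1 ?_
  obtain ⟨m, hm⟩ := hB.exists_mem_coradicalFiltration hb x
  exact key m x hm

end Conilpotent

/-! ### Convolution and divided powers -/

section Convolution

open Coalgebra TensorProduct

variable {K : Type u} [Field K] {B : Type w} [AddCommGroup B] [Module K B] [Coalgebra K B] {b : B}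
  {C : Type v} [AddCommGroup C] [Module K C] {e : C}

/-- The convolution of linear maps from a coalgebra with respect to a binary operation `μ` on the
target. -/
noncomputable def convolution (μ : C ⊗[K] C →ₗ[K] C) (g h : B →ₗ[K] C) : B →ₗ[K] C :=
  μ ∘ₗ TensorProduct.map g h ∘ₗ comul

theorem convolution_apply (μ : C ⊗[K] C →ₗ[K] C) (g h : B →ₗ[K] C) (c : B) :
    convolution μ g h c = μ (TensorProduct.map g h (comul (R := K) c)) := rfl

theorem convolution_counit_smulRight {μ : C ⊗[K] C →ₗ[K] C} (h1 : ∀ a, μ (a ⊗ₜ e) = a)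
    (g : B →ₗ[K] C) : convolution μ g ((counit (R := K)).smulRight e) = g := by
  ext c
  have h : TensorProduct.map g ((counit (R := K) (A := B)).smulRight e) =
      TensorProduct.map g (LinearMap.toSpanSingleton K C e) ∘ₗ
        (counit (R := K) (A := B)).lTensor B := by
    ext; simp
  rw [convolution_apply, h, LinearMap.comp_apply, lTensor_counit_comul]
  simp [h1]

theorem counit_smulRight_convolution {μ : C ⊗[K] C →ₗ[K] C} (h1 : ∀ a, μ (e ⊗ₜ a) = a)
    (g : B →ₗ[K] C) : convolution μ ((counit (R := K)).smulRight e) g = g := by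
  ext c
  have h : TensorProduct.map ((counit (R := K) (A := B)).smulRight e) g =
      TensorProduct.map (LinearMap.toSpanSingleton K C e) g ∘ₗ
        (counit (R := K) (A := B)).rTensor B := by
    ext; simp
  rw [convolution_apply, h, LinearMap.comp_apply, rTensor_counit_comul]
  simp [h1]

theorem convolution_self (hb : IsGroupLikeElem K b) (μ : C ⊗[K] C →ₗ[K] C) (g h : B →ₗ[K] C) :
    convolution μ g h b = μ (g b ⊗ₜ h b) := by
  simp [convolution_apply, hb.comul_eq_tmul_self]

/-- The terms `c ⊗ b` and `b ⊗ c` die, so only `Δ'` contributes and each such product gains one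
filtration step. -/
theorem convolution_apply_of_vanishing (hb : IsGroupLikeElem K b) (μ : C ⊗[K] C →ₗ[K] C)
    {g h : B →ₗ[K] C} (hg : g b = 0) (hh : h b = 0) (c : B) :
    convolution μ g h c = μ (TensorProduct.map g h (reducedComul K b c)) := by
  have h1 : convolution μ g h c = convolution μ g h (augProj K b c) := by
    rw [augProj_apply, map_sub, map_smul, convolution_self hb, hg]
    simp
  rw [h1, convolution_apply, comul_augProj]
  simp [hg, hh]

/-- The convolution of linear maps compatible with the comultiplication, for a target with a
binary operation that is a morphism of coalgebras. -/
theorem comul_convolution [Coalgebra K C] [IsCocomm K B] (μ : C ⊗[K] C →ₗc[K] C) (g h : B →ₗ[K] C)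
    {ι κ : Type*} (s : Finset ι) (t : Finset κ) (g₁ g₂ : ι → B →ₗ[K] C) (h₁ h₂ : κ → B →ₗ[K] C)
    (hg : comul ∘ₗ g = ∑ i ∈ s, TensorProduct.map (g₁ i) (g₂ i) ∘ₗ comul)
    (hh : comul ∘ₗ h = ∑ j ∈ t, TensorProduct.map (h₁ j) (h₂ j) ∘ₗ comul) :
    comul ∘ₗ convolution (μ : C ⊗[K] C →ₗ[K] C) g h = ∑ i ∈ s, ∑ j ∈ t,
      TensorProduct.map (convolution μ (g₁ i) (h₁ j)) (convolution μ (g₂ i) (h₂ j)) ∘ₗ comul := by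
  -- Cocommutativity enters here: it makes `Δ : B → B ⊗ B` a coalgebra morphism.
  have hB : (tensorTensorTensorComm K B B B B).toLinearMap ∘ₗ
      TensorProduct.map comul comul ∘ₗ comul (R := K) (A := B) =
        TensorProduct.map comul comul ∘ₗ comul :=
    (comulCoalgHom K B).map_comp_comul.symm
  have hμ : comul ∘ₗ (μ : C ⊗[K] C →ₗ[K] C) =
      TensorProduct.map (μ : C ⊗[K] C →ₗ[K] C) (μ : C ⊗[K] C →ₗ[K] C) ∘ₗ
        (tensorTensorTensorComm K C C C C).toLinearMap ∘ₗ TensorProduct.map comul comul :=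
    μ.map_comp_comul.symm
  have h1 : ∀ i j, (tensorTensorTensorComm K C C C C).toLinearMap ∘ₗ
      TensorProduct.map (TensorProduct.map (g₁ i) (g₂ i) ∘ₗ comul)
        (TensorProduct.map (h₁ j) (h₂ j) ∘ₗ comul) ∘ₗ comul (R := K) (A := B) =
      TensorProduct.map (TensorProduct.map (g₁ i) (h₁ j)) (TensorProduct.map (g₂ i) (h₂ j)) ∘ₗ
        TensorProduct.map comul comul ∘ₗ comul := by
    intro i j
    rw [← hB, TensorProduct.map_comp, LinearMap.comp_assoc, ← LinearMap.comp_assoc,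
      tensorTensorTensorComm_comp_map, LinearMap.comp_assoc]
  have h2 : ∀ i j, TensorProduct.map (convolution (μ : C ⊗[K] C →ₗ[K] C) (g₁ i) (h₁ j))
        (convolution (μ : C ⊗[K] C →ₗ[K] C) (g₂ i) (h₂ j)) ∘ₗ comul =
      TensorProduct.map (μ : C ⊗[K] C →ₗ[K] C) (μ : C ⊗[K] C →ₗ[K] C) ∘ₗ
        ((tensorTensorTensorComm K C C C C).toLinearMap ∘ₗ
      TensorProduct.map (TensorProduct.map (g₁ i) (g₂ i) ∘ₗ comul)
        (TensorProduct.map (h₁ j) (h₂ j) ∘ₗ comul) ∘ₗ comul (R := K) (A := B)) := by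
    intro i j
    rw [h1, convolution, convolution, TensorProduct.map_comp, TensorProduct.map_comp]
    simp only [LinearMap.comp_assoc]
  have h3 : TensorProduct.map (comul (R := K)) comul ∘ₗ TensorProduct.map g h =
      ∑ i ∈ s, ∑ j ∈ t, TensorProduct.map (TensorProduct.map (g₁ i) (g₂ i) ∘ₗ comul (R := K))
        (TensorProduct.map (h₁ j) (h₂ j) ∘ₗ comul (R := K)) := by
    rw [← TensorProduct.map_comp, hg, hh]
    refine TensorProduct.ext' fun x y => ?_
    simp only [TensorProduct.map_tmul, LinearMap.sum_apply, TensorProduct.sum_tmul,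
      TensorProduct.tmul_sum]
    exact Finset.sum_comm
  have h4 : comul ∘ₗ convolution (μ : C ⊗[K] C →ₗ[K] C) g h =
      TensorProduct.map (μ : C ⊗[K] C →ₗ[K] C) (μ : C ⊗[K] C →ₗ[K] C) ∘ₗ
        (tensorTensorTensorComm K C C C C).toLinearMap ∘ₗ
          (TensorProduct.map comul comul ∘ₗ TensorProduct.map g h) ∘ₗ comul := by
    rw [convolution, ← LinearMap.comp_assoc, hμ]
    simp only [LinearMap.comp_assoc]
  rw [h4, h3]
  simp only [h2]
  ext c
  simp [LinearMap.sum_apply, map_sum]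

theorem counit_convolution [Coalgebra K C] (μ : C ⊗[K] C →ₗc[K] C) (g : B →ₗ[K] C) {h : B →ₗ[K] C}
    (hh : counit (R := K) ∘ₗ h = 0) :
    counit (R := K) ∘ₗ convolution (μ : C ⊗[K] C →ₗ[K] C) g h = 0 := by
  have h1 : counit (R := K) ∘ₗ (μ : C ⊗[K] C →ₗ[K] C) = counit := μ.counit_comp
  have h2 : counit (R := K) ∘ₗ TensorProduct.map g h = 0 := by
    refine TensorProduct.ext' fun x y => ?_
    have : counit (R := K) (h y) = 0 := LinearMap.congr_fun hh y
    simp [this]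
  rw [convolution, ← LinearMap.comp_assoc, h1, ← LinearMap.comp_assoc, h2, LinearMap.zero_comp]

/-- The `n`-th divided power of `f` for the left-normed convolution product. -/
noncomputable def convDivPow (μ : C ⊗[K] C →ₗ[K] C) (e : C) (f : B →ₗ[K] C) : ℕ → B →ₗ[K] C
  | 0 => counit.smulRight e
  | n + 1 => ((n + 1 : ℕ) : K)⁻¹ • convolution μ (convDivPow μ e f n) f

theorem convDivPow_zero (μ : C ⊗[K] C →ₗ[K] C) (e : C) (f : B →ₗ[K] C) :
    convDivPow μ e f 0 = counit.smulRight e := rfl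

theorem convDivPow_succ (μ : C ⊗[K] C →ₗ[K] C) (e : C) (f : B →ₗ[K] C) (n : ℕ) :
    convDivPow μ e f (n + 1) = ((n + 1 : ℕ) : K)⁻¹ • convolution μ (convDivPow μ e f n) f := rfl

theorem convolution_convDivPow [CharZero K] (μ : C ⊗[K] C →ₗ[K] C) (e : C) (f : B →ₗ[K] C)
    (n : ℕ) :
    convolution μ (convDivPow μ e f n) f = ((n + 1 : ℕ) : K) • convDivPow μ e f (n + 1) := by
  rw [convDivPow_succ, smul_inv_smul₀ (Nat.cast_ne_zero.2 n.succ_ne_zero)]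

theorem convDivPow_one {μ : C ⊗[K] C →ₗ[K] C} (h1 : ∀ a, μ (e ⊗ₜ a) = a) (f : B →ₗ[K] C) :
    convDivPow μ e f 1 = f := by
  simp [convDivPow_succ, convDivPow_zero, counit_smulRight_convolution h1]

theorem convDivPow_succ_self (hb : IsGroupLikeElem K b) (μ : C ⊗[K] C →ₗ[K] C) (e : C)
    {f : B →ₗ[K] C} (hf : f b = 0) (n : ℕ) : convDivPow μ e f (n + 1) b = 0 := by
  simp [convDivPow_succ, convolution_self hb, hf]

theorem counit_convDivPow_succ [Coalgebra K C] (μ : C ⊗[K] C →ₗc[K] C) (e : C) {f : B →ₗ[K] C}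
    (hf : counit (R := K) ∘ₗ f = 0) (n : ℕ) :
    counit (R := K) ∘ₗ convDivPow (μ : C ⊗[K] C →ₗ[K] C) e f (n + 1) = 0 := by
  rw [convDivPow_succ, LinearMap.comp_smul, counit_convolution μ _ hf, smul_zero]

theorem convDivPow_eq_zero (hb : IsGroupLikeElem K b) (μ : C ⊗[K] C →ₗ[K] C)
    (e : C) {f : B →ₗ[K] C} (hf : f b = 0) {m n : ℕ} (hmn : m ≤ n) {c : B}
    (hc : c ∈ coradicalFiltration K b m) : convDivPow μ e f (n + 1) c = 0 := by
  induction m generalizing n c with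
  | zero =>
    have h := mem_coradicalFiltration_zero.1 hc
    rw [augProj_apply, sub_eq_zero] at h
    rw [h, map_smul, convDivPow_succ_self hb μ e hf, smul_zero]
  | succ m ih =>
    obtain ⟨n, rfl⟩ : ∃ k, n = k + 1 := ⟨n - 1, by omega⟩
    rw [convDivPow_succ, LinearMap.smul_apply, convolution_apply_of_vanishing hb μ
      (convDivPow_succ_self hb μ e hf n) hf,
      map_reducedComul_eq_zero hb f (fun c hc => ih (by omega) hc) hc, map_zero, smul_zero]

/-- The source of the contraction. Powers with at least two factors are computed through `Δ'`, so
their values one step higher depend only on `f` on step `m`; the first power, `f` itself, must be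
excluded. -/
theorem convDivPow_congr [IsCocomm K B] (hb : IsGroupLikeElem K b) {μ : C ⊗[K] C →ₗ[K] C}
    (h1 : ∀ a, μ (e ⊗ₜ a) = a) {f g : B →ₗ[K] C} (hf : f b = 0) (hg : g b = 0) {m : ℕ}
    (hfg : ∀ c ∈ coradicalFiltration K b m, f c = g c) (n : ℕ) {c : B}
    (hc : c ∈ coradicalFiltration K b (m + 1)) :
    convDivPow μ e f (n + 2) c = convDivPow μ e g (n + 2) c := by
  have step : ∀ n, (∀ c ∈ coradicalFiltration K b m,
      convDivPow μ e f (n + 1) c = convDivPow μ e g (n + 1) c) →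
      ∀ c ∈ coradicalFiltration K b (m + 1),
        convDivPow μ e f (n + 2) c = convDivPow μ e g (n + 2) c := by
    intro n hn c hc
    rw [convDivPow_succ, convDivPow_succ _ _ g, LinearMap.smul_apply, LinearMap.smul_apply,
      convolution_apply_of_vanishing hb μ (convDivPow_succ_self hb μ e hf n) hf,
      convolution_apply_of_vanishing hb μ (convDivPow_succ_self hb μ e hg n) hg]
    congr 2
    have h2 := map_reducedComul_eq_zero hb f
      (φ := convDivPow μ e f (n + 1) - convDivPow μ e g (n + 1))
      (fun c hc => by rw [LinearMap.sub_apply, hn c hc, sub_self]) hc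
    have h3 := map_reducedComul_eq_zero' hb (convDivPow μ e g (n + 1)) (φ := f - g)
      (fun c hc => by rw [LinearMap.sub_apply, hfg c hc, sub_self]) hc
    rw [← sub_eq_zero, ← LinearMap.sub_apply, ← add_zero (0 : C ⊗[K] C)]
    nth_rewrite 2 [← h2]
    rw [← h3, ← LinearMap.add_apply]
    congr 1
    refine TensorProduct.ext' fun x y => ?_
    simp [TensorProduct.sub_tmul, TensorProduct.tmul_sub]
  induction n generalizing c with
  | zero =>
    refine step 0 (fun c hc => ?_) c hc
    rw [zero_add, convDivPow_one h1, convDivPow_one h1, hfg c hc]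
  | succ n ih => exact step (n + 1) (fun c hc => ih (coradicalFiltration_le_succ hb m hc)) c hc

/-- The divided power identity, by induction on the last factor. It survives nonassociativity
because every power is left-normed: multiplying by `f ⊗ η` or `η ⊗ f` just raises one of the two
indices. -/
theorem comul_convDivPow [Coalgebra K C] [CharZero K] [IsCocomm K B] (he : IsGroupLikeElem K e)
    (μ : C ⊗[K] C →ₗc[K] C) (h1 : ∀ a, μ (a ⊗ₜ e) = a) {f : B →ₗ[K] C}
    (hf : ∀ c, f c ∈ primitiveElements K e) (n : ℕ) :
    comul ∘ₗ convDivPow (μ : C ⊗[K] C →ₗ[K] C) e f n =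
      ∑ ij ∈ Finset.HasAntidiagonal.antidiagonal n, TensorProduct.map (convDivPow μ e f ij.1)
        (convDivPow μ e f ij.2) ∘ₗ comul := by
  set η : B →ₗ[K] C := (counit (R := K)).smulRight e with hη
  -- Primitivity of the values of `f` as `Δ f = (f ⊗ η + η ⊗ f) Δ`, with `η` the convolution unit;
  -- `Bool` indexes the two terms.
  have hf' : comul ∘ₗ f = ∑ i : Bool, TensorProduct.map (if i then f else η)
      (if i then η else f) ∘ₗ comul := by
    ext c
    have h2 : TensorProduct.map f η (comul (R := K) c) = f c ⊗ₜ e := by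
      have : TensorProduct.map f η = TensorProduct.map f (LinearMap.toSpanSingleton K C e) ∘ₗ
          (counit (R := K) (A := B)).lTensor B := by ext; simp [hη]
      rw [this, LinearMap.comp_apply, lTensor_counit_comul]
      simp
    have h3 : TensorProduct.map η f (comul (R := K) c) = e ⊗ₜ f c := by
      have : TensorProduct.map η f = TensorProduct.map (LinearMap.toSpanSingleton K C e) f ∘ₗ
          (counit (R := K) (A := B)).rTensor B := by ext; simp [hη]
      rw [this, LinearMap.comp_apply, rTensor_counit_comul]
      simp
    have := mem_primitiveElements.1 (hf c)
    simp [h2, h3, this]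
  induction n with
  | zero =>
    ext c
    have h2 : TensorProduct.map η η (comul (R := K) c) = counit (R := K) c • e ⊗ₜ[K] e := by
      have : TensorProduct.map η η = TensorProduct.map (LinearMap.toSpanSingleton K C e) η ∘ₗ
          (counit (R := K) (A := B)).rTensor B := by ext; simp [hη]
      rw [this, LinearMap.comp_apply, rTensor_counit_comul]
      simp [hη]
    simp [convDivPow_zero, ← hη, h2]
    simp [hη, he.comul_eq_tmul_self]
  | succ n ih =>
    have h2 := comul_convolution μ _ f _ _ _ _ _ _ ih hf'
    rw [convolution_convDivPow] at h2
    simp only [Fintype.sum_bool, if_true, Bool.false_eq_true, if_false, hη,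
      convolution_counit_smulRight (μ := (μ : C ⊗[K] C →ₗ[K] C)) h1, convolution_convDivPow] at h2
    have h3 : ((n + 1 : ℕ) : K) ≠ 0 := Nat.cast_ne_zero.2 n.succ_ne_zero
    refine smul_right_injective _ h3 ?_
    change _ • _ = _ • _
    rw [← LinearMap.comp_smul, h2, Finset.sum_add_distrib, Finset.smul_sum]
    -- Split the weight as `n + 1 = i + j`. The boundary terms have weight `0`, and shifting the
    -- index in each half gives the two sums in `h2`.
    have h4 : ∀ ij ∈ Finset.HasAntidiagonal.antidiagonal (n + 1), ((n + 1 : ℕ) : K) •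
        (TensorProduct.map (convDivPow (μ : C ⊗[K] C →ₗ[K] C) e f ij.1)
          (convDivPow (μ : C ⊗[K] C →ₗ[K] C) e f ij.2) ∘ₗ comul (R := K)) =
        (ij.1 : K) • (TensorProduct.map (convDivPow (μ : C ⊗[K] C →ₗ[K] C) e f ij.1)
          (convDivPow (μ : C ⊗[K] C →ₗ[K] C) e f ij.2) ∘ₗ comul (R := K)) +
        (ij.2 : K) • (TensorProduct.map (convDivPow (μ : C ⊗[K] C →ₗ[K] C) e f ij.1)
          (convDivPow (μ : C ⊗[K] C →ₗ[K] C) e f ij.2) ∘ₗ comul (R := K)) := by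
      intro ij hij
      rw [← add_smul, ← Nat.cast_add, Finset.HasAntidiagonal.mem_antidiagonal.1 hij]
    rw [Finset.sum_congr rfl h4, Finset.sum_add_distrib, Finset.Nat.sum_antidiagonal_succ,
      Finset.Nat.sum_antidiagonal_succ']
    simp [TensorProduct.map_smul_left, TensorProduct.map_smul_right, LinearMap.smul_comp]

/-! ### The convolution exponential and existence of lifts -/

/-- `F` is the exponential of `f` for the left-normed convolution product. -/
def IsConvExp (b : B) (μ : C ⊗[K] C →ₗ[K] C) (e : C) (f F : B →ₗ[K] C) : Prop :=
  ∀ m, ∀ c ∈ coradicalFiltration K b m, F c = ∑ n ∈ Finset.range (m + 1), convDivPow μ e f n c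

/-- The truncations glue because the power of index `m + 1` vanishes on step `m`. -/
theorem exists_isConvExp (hb : IsGroupLikeElem K b) (hB : IsConilpotent K b)
    (μ : C ⊗[K] C →ₗ[K] C) (e : C) {f : B →ₗ[K] C} (hf : f b = 0) :
    ∃ F, IsConvExp b μ e f F := by
  obtain ⟨F, hF⟩ := LinearMap.exists_eq_on_of_filtration (monotone_coradicalFiltration hb)
    (hB.exists_mem_coradicalFiltration hb)
    (fun m => ∑ n ∈ Finset.range (m + 1), convDivPow μ e f n) fun m c hc => by
      rw [Finset.sum_range_succ, LinearMap.add_apply,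
        convDivPow_eq_zero hb μ e hf le_rfl hc, add_zero]
  exact ⟨F, fun m c hc => by rw [hF m c hc, LinearMap.sum_apply]⟩

theorem self_mem_coradicalFiltration (hb : IsGroupLikeElem K b) (m : ℕ) :
    b ∈ coradicalFiltration K b m := by
  simp [mem_coradicalFiltration, augProj_self hb]

theorem IsConvExp.apply_self (hb : IsGroupLikeElem K b) {μ : C ⊗[K] C →ₗ[K] C} {e : C}
    {f F : B →ₗ[K] C} (hF : IsConvExp b μ e f F) : F b = e := by
  rw [hF 0 b (self_mem_coradicalFiltration hb 0)]
  simp [convDivPow_zero, hb.counit_eq_one]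

theorem IsConvExp.counit_comp [Coalgebra K C] (he : IsGroupLikeElem K e) (hb : IsGroupLikeElem K b)
    (hB : IsConilpotent K b) {μ : C ⊗[K] C →ₗc[K] C} {f F : B →ₗ[K] C}
    (hf : ∀ c, f c ∈ primitiveElements K e) (hF : IsConvExp b (μ : C ⊗[K] C →ₗ[K] C) e f F) :
    counit (R := K) ∘ₗ F = counit := by
  ext c
  obtain ⟨m, hm⟩ := hB.exists_mem_coradicalFiltration hb c
  have h : ∀ n, counit (R := K) (convDivPow (μ : C ⊗[K] C →ₗ[K] C) e f (n + 1) c) = 0 := fun n =>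
    LinearMap.congr_fun (counit_convDivPow_succ μ e
      (LinearMap.ext fun c => counit_eq_zero_of_mem_primitiveElements he (hf c)) n) c
  rw [LinearMap.comp_apply, hF m c hm, map_sum, Finset.sum_range_succ']
  simp [h, convDivPow_zero, he.counit_eq_one]

/-- A Cauchy product: only finitely many terms act on a given tensor. The bound is left open above
so that it can be matched with the truncation of `F` in the next theorem. -/
theorem IsConvExp.exists_map_eq_sum (hb : IsGroupLikeElem K b) (hB : IsConilpotent K b)
    {μ : C ⊗[K] C →ₗ[K] C} {f F : B →ₗ[K] C} (hf : f b = 0) (hF : IsConvExp b μ e f F)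
    (z : B ⊗[K] B) : ∃ M, ∀ N, M ≤ N → TensorProduct.map F F z = ∑ n ∈ Finset.range N,
      ∑ ij ∈ Finset.HasAntidiagonal.antidiagonal n,
        TensorProduct.map (convDivPow μ e f ij.1) (convDivPow μ e f ij.2) z := by
  induction z with
  | zero => exact ⟨0, fun N _ => by simp⟩
  | add x y hx hy =>
    obtain ⟨M, hM⟩ := hx
    obtain ⟨M', hM'⟩ := hy
    refine ⟨max M M', fun N hN => ?_⟩
    rw [map_add, hM N (le_trans (le_max_left _ _) hN), hM' N (le_trans (le_max_right _ _) hN)]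
    simp [Finset.sum_add_distrib]
  | tmul x y =>
    obtain ⟨k, hk⟩ := hB.exists_mem_coradicalFiltration hb x
    obtain ⟨l, hl⟩ := hB.exists_mem_coradicalFiltration hb y
    have hk' : ∀ i, k < i → convDivPow μ e f i x = 0 := by
      intro i hi
      obtain ⟨j, rfl⟩ : ∃ j, i = j + 1 := ⟨i - 1, by omega⟩
      exact convDivPow_eq_zero hb μ e hf (by omega) hk
    have hl' : ∀ i, l < i → convDivPow μ e f i y = 0 := by
      intro i hi
      obtain ⟨j, rfl⟩ : ∃ j, i = j + 1 := ⟨i - 1, by omega⟩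
      exact convDivPow_eq_zero hb μ e hf (by omega) hl
    -- Nonzero terms have `i ≤ k` and `j ≤ l`, hence `i + j < k + l + 1`.
    refine ⟨k + l + 1, fun N hN => ?_⟩
    simp only [TensorProduct.map_tmul]
    rw [hF k x hk, hF l y hl, TensorProduct.sum_tmul]
    simp only [TensorProduct.tmul_sum]
    rw [← Finset.sum_product', ← Finset.sum_fiberwise_of_maps_to (t := Finset.range N)
      (g := fun ij : ℕ × ℕ => ij.1 + ij.2)]
    · refine Finset.sum_congr rfl fun n _ => Finset.sum_subset ?_ ?_
      · intro ij hij
        exact Finset.HasAntidiagonal.mem_antidiagonal.2 (Finset.mem_filter.1 hij).2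
      · intro ij hij hij'
        rw [Finset.HasAntidiagonal.mem_antidiagonal] at hij
        simp only [Finset.mem_filter, Finset.mem_product, Finset.mem_range, hij, and_true,
          not_and_or, not_lt] at hij'
        rcases hij' with h | h
        · rw [hk' _ (by omega), TensorProduct.zero_tmul]
        · rw [hl' _ (by omega), TensorProduct.tmul_zero]
    · intro ij hij
      simp only [Finset.mem_product, Finset.mem_range] at hij ⊢
      omega

theorem IsConvExp.map_comp_comul [Coalgebra K C] [CharZero K] [IsCocomm K B]
    (he : IsGroupLikeElem K e) (hb : IsGroupLikeElem K b)
    (hB : IsConilpotent K b) {μ : C ⊗[K] C →ₗc[K] C} (h1 : ∀ a, μ (a ⊗ₜ e) = a)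
    {f F : B →ₗ[K] C} (hf : f b = 0) (hfp : ∀ c, f c ∈ primitiveElements K e)
    (hF : IsConvExp b (μ : C ⊗[K] C →ₗ[K] C) e f F) :
    TensorProduct.map F F ∘ₗ comul = comul (R := K) ∘ₗ F := by
  ext c
  obtain ⟨m, hm⟩ := hB.exists_mem_coradicalFiltration hb c
  obtain ⟨M, hM⟩ := hF.exists_map_eq_sum hb hB hf (comul (R := K) c)
  rw [LinearMap.comp_apply, hM (max M (m + 1)) (le_max_left _ _), LinearMap.comp_apply,
    hF (max M (m + 1) - 1) c (monotone_coradicalFiltration hb (by omega) hm), map_sum,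
    show max M (m + 1) - 1 + 1 = max M (m + 1) by omega]
  refine Finset.sum_congr rfl fun n _ => ?_
  have := LinearMap.congr_fun (comul_convDivPow he μ h1 hfp n) c
  simp only [LinearMap.comp_apply, LinearMap.sum_apply] at this
  exact this.symm

/-- A coaugmented coalgebra over a field of characteristic zero is cofree among the conilpotent
cocommutative coalgebras if it carries a binary operation that is a morphism of coalgebras with the
coaugmentation as a two-sided unit. Associativity is not needed. -/
theorem isCofreeCocommutative_of_unital_mul [CharZero K] [Coalgebra K C]
    (he : IsGroupLikeElem K e) (μ : C ⊗[K] C →ₗc[K] C) (h1 : ∀ a, μ (e ⊗ₜ a) = a)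
    (h2 : ∀ a, μ (a ⊗ₜ e) = a) (p : C →ₗ[K] primitiveElements K e) (hpe : p e = 0)
    (hp : ∀ c : primitiveElements K e, p c = c) : IsCofreeCocommutative.{u, v, w} K e p := by
  refine ⟨hpe, ?_⟩
  intro B _ _ _ _ b hb hB f hf
  set ι : primitiveElements K e →ₗ[K] C := (primitiveElements K e).subtype with hι
  set S := coradicalFiltration K b with hS
  have hex : ∀ g : B →ₗ[K] primitiveElements K e, g b = 0 →
      ∃ F, IsConvExp b (μ : C ⊗[K] C →ₗ[K] C) e (ι ∘ₗ g) F := fun g hg =>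
    exists_isConvExp hb hB _ e (by simp [hg])
  -- `E` is total, but it is an exponential only for maps vanishing at `b`; hence the vanishing
  -- conditions carried along below.
  choose! E hE using hex
  have hcontr : ∀ g h : B →ₗ[K] primitiveElements K e, g b = 0 → h b = 0 → ∀ m,
      (∀ c ∈ S m, g c = h c) → ∀ c ∈ S (m + 1), E g c - g c = E h c - h c := by
    intro g h hg hh m hgh c hc
    -- Index `0` contributes `ε(c) e`, independent of `g`, and index `1` cancels `g`; what remains
    -- has at least two factors.
    have hE' : ∀ g : B →ₗ[K] primitiveElements K e, g b = 0 → E g c - g c =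
        ∑ n ∈ Finset.range m, convDivPow (μ : C ⊗[K] C →ₗ[K] C) e (ι ∘ₗ g) (n + 2) c +
          counit (R := K) c • e := by
      intro g hg
      rw [hE g hg _ c hc, Finset.sum_range_succ', Finset.sum_range_succ', zero_add,
        convDivPow_one (μ := (μ : C ⊗[K] C →ₗ[K] C)) h1, convDivPow_zero]
      simp only [hι, LinearMap.comp_apply, Submodule.subtype_apply, LinearMap.smulRight_apply]
      abel
    rw [hE' g hg, hE' h hh]
    congr 1
    exact Finset.sum_congr rfl fun n _ => convDivPow_congr hb h1 (by simp [hg]) (by simp [hh])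
      (fun c hc => by simp [hgh c hc]) n hc
  -- As `p` fixes primitives, `Φ g = g` amounts to `p ∘ E g = f`.
  set Φ : (B →ₗ[K] primitiveElements K e) → (B →ₗ[K] primitiveElements K e) :=
    fun g => f - p ∘ₗ (E g - ι ∘ₗ g) with hΦ
  have hΦb : ∀ g, g b = 0 → Φ g b = 0 := by
    intro g hg
    simp [hΦ, hg, hf, (hE g hg).apply_self hb, hpe]
  have hΦS : ∀ g h : B →ₗ[K] primitiveElements K e, g b = 0 → h b = 0 → ∀ m,
      (∀ c ∈ S m, g c = h c) → ∀ c ∈ S (m + 1), Φ g c = Φ h c := by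
    intro g h hg hh m hgh c hc
    have := hcontr g h hg hh m hgh c hc
    simp only [hΦ, LinearMap.sub_apply, LinearMap.comp_apply, hι, Submodule.subtype_apply, this]
  have hS0 : ∀ g h : B →ₗ[K] primitiveElements K e, g b = 0 → h b = 0 → ∀ c ∈ S 0, g c = h c := by
    intro g h hg hh c hc
    have h := mem_coradicalFiltration_zero.1 hc
    rw [augProj_apply, sub_eq_zero] at h
    rw [h, map_smul, map_smul, hg, hh]
  have hitb : ∀ m, (Φ^[m] 0) b = 0 := by
    intro m
    induction m with
    | zero => rfl
    | succ m ih => rw [Function.iterate_succ_apply']; exact hΦb _ ih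
  have hit : ∀ m, ∀ c ∈ S m, (Φ^[m + 1] 0) c = (Φ^[m] 0) c := by
    intro m
    induction m with
    | zero => exact hS0 _ _ (hitb 1) (hitb 0)
    | succ m ih =>
      intro c hc
      rw [Function.iterate_succ_apply' Φ (m + 1)]
      conv_rhs => rw [Function.iterate_succ_apply' Φ m]
      exact hΦS _ _ (hitb (m + 1)) (hitb m) m ih c hc
  obtain ⟨g, hg⟩ := LinearMap.exists_eq_on_of_filtration (monotone_coradicalFiltration hb)
    (hB.exists_mem_coradicalFiltration hb) (fun m => Φ^[m] 0) hit
  have hgb : g b = 0 := by rw [hg 0 b (self_mem_coradicalFiltration hb 0)]; rfl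
  have hfix : Φ g = g := by
    ext1 c
    obtain ⟨m, hm⟩ := hB.exists_mem_coradicalFiltration hb c
    have hm' := coradicalFiltration_le_succ hb m hm
    rw [hΦS g (Φ^[m] 0) hgb (hitb m) m (hg m) c hm', ← Function.iterate_succ_apply' Φ,
      hg (m + 1) c hm']
  have hfp : ∀ c, (ι ∘ₗ g) c ∈ primitiveElements K e := fun c => (g c).2
  have hpE : ∀ x, p (E g x) = f x := by
    intro x
    have h3 : f x - (p (E g x) - p (g x)) = g x := by
      rw [← map_sub]; exact LinearMap.congr_fun hfix x
    rw [hp, ← sub_eq_zero] at h3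
    rw [← sub_eq_zero, ← neg_eq_zero, ← h3]
    abel
  refine ⟨{ E g with
    counit_comp := (hE g hgb).counit_comp he hb hB hfp
    map_comp_comul := (hE g hgb).map_comp_comul he hb hB h2 (by simp [hgb]) hfp },
    ⟨(hE g hgb).apply_self hb, hpE⟩, fun G hG => ?_⟩
  exact CoalgHom.eq_of_projection_eq hb hB p hp hG.1 ((hE g hgb).apply_self hb) fun x =>
    (hG.2 x).trans (hpE x).symm

end Convolution

/-! ### Multilinear preliminaries -/

theorem Module.Basis.multilinearExt_tensorProduct_tmul {K M P ι κ : Type*} [Field K]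
    [AddCommGroup M] [Module K M] [AddCommGroup P] [Module K P] (b : Module.Basis ι K M)
    (c : Module.Basis κ K P) {k : ℕ} (g : (Fin k → ι) → ι) (h : (Fin k → κ) → κ)
    (x : Fin k → M) (y : Fin k → P) :
    (b.tensorProduct c).multilinearExt
        (fun s : Fin k → ι × κ => (g fun i => (s i).1, h fun i => (s i).2))
        (fun i => x i ⊗ₜ[K] y i) =
      b.multilinearExt g x ⊗ₜ[K] c.multilinearExt h y := by
  set T := (b.tensorProduct c).multilinearExt
    (fun s : Fin k → ι × κ => (g fun i => (s i).1, h fun i => (s i).2)) with hT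
  have h0 : ∀ s t, T (fun i => b (s i) ⊗ₜ[K] c (t i)) = b (g s) ⊗ₜ[K] c (h t) := by
    intro s t
    have := Module.Basis.multilinearExt_apply (b.tensorProduct c)
      (fun s : Fin k → ι × κ => (g fun i => (s i).1, h fun i => (s i).2)) fun i => (s i, t i)
    simpa using this
  have h1 : ∀ s, T.compLinearMap (fun i => TensorProduct.mk K M P (b (s i))) =
      (TensorProduct.mk K M P (b (g s))).compMultilinearMap (c.multilinearExt h) := by
    intro s
    refine Module.Basis.ext_multilinear (fun _ => c) fun t => ?_
    simp [Module.Basis.multilinearExt_apply, h0]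
  have h2 : T.compLinearMap (fun i => (TensorProduct.mk K M P).flip (y i)) =
      ((TensorProduct.mk K M P).flip (c.multilinearExt h y)).compMultilinearMap
        (b.multilinearExt g) := by
    refine Module.Basis.ext_multilinear (fun _ => b) fun s => ?_
    simpa [Module.Basis.multilinearExt_apply] using congrArg (fun f => f y) (h1 s)
  simpa using congrArg (fun f => f x) h2

/-- The bilinear map given by a multilinear map in two variables. -/
noncomputable def MultilinearMap.toBilin {K M P : Type*} [Field K] [AddCommGroup M] [Module K M]
    [AddCommGroup P] [Module K P] (f : MultilinearMap K (fun _ : Fin 2 => M) P) :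
    M →ₗ[K] M →ₗ[K] P :=
  LinearMap.mk₂ K (fun a b => f ![a, b])
    (fun a a' b => by simpa using f.cons_add (Matrix.vecCons b ![]) a a')
    (fun r a b => by simpa using f.cons_smul (Matrix.vecCons b ![]) r a)
    (fun a b b' => (f.curryLeft a).cons_add ![] b b')
    (fun r a b => (f.curryLeft a).cons_smul ![] r b)

theorem MultilinearMap.toBilin_apply {K M P : Type*} [Field K] [AddCommGroup M] [Module K M]
    [AddCommGroup P] [Module K P] (f : MultilinearMap K (fun _ : Fin 2 => M) P) (a b : M) :
    f.toBilin a b = f ![a, b] := rfl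

/-! ### Counting leaves -/

namespace MagTree

variable {N : ℕ∞} {X : Type v}

/-- The number of leaves of a tree. -/
def leafCount : MagTree N X → ℕ
  | .leaf _ => 1
  | .node _ _ _ c => ∑ i, leafCount (c i)

theorem leafCount_pos (t : MagTree N X) : 0 < t.leafCount := by
  induction t with
  | leaf x => exact one_pos
  | node k h2 hk c ih =>
    have : NeZero k := ⟨by omega⟩
    exact Finset.sum_pos (fun i _ => ih i) Finset.univ_nonempty

/-- The number of leaves of a possibly empty tree. -/
def optionLeafCount (t : Option (MagTree N X)) : ℕ := t.elim 0 leafCount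

theorem optionLeafCount_some (t : MagTree N X) : optionLeafCount (some t) = t.leafCount := rfl

theorem optionLeafCount_none : optionLeafCount (none : Option (MagTree N X)) = 0 := rfl

theorem optionLeafCount_eq_zero {t : Option (MagTree N X)} : optionLeafCount t = 0 ↔ t = none := by
  cases t with
  | none => simp [optionLeafCount_none]
  | some t => simpa [optionLeafCount_some] using t.leafCount_pos.ne'

theorem optionLeafCount_graftList (l : List (MagTree N X)) (h : (l.length : ℕ∞) ≤ N) :
    optionLeafCount (graftList l h) = (l.map leafCount).sum := by
  match l, h with
  | [], _ => rfl
  | [t], _ => simp [graftList, optionLeafCount]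
  | t :: t' :: l, h =>
    rw [graftList, optionLeafCount_some, leafCount, ← List.sum_ofFn]
    congr 1
    refine List.ext_getElem (by simp) fun i _ _ => by simp

theorem optionLeafCount_graft {k : ℕ} (hk : (k : ℕ∞) ≤ N) (s : Fin k → Option (MagTree N X)) :
    optionLeafCount (graft hk s) = ∑ i, optionLeafCount (s i) := by
  have h : ∀ l : List (Option (MagTree N X)),
      (l.reduceOption.map leafCount).sum = (l.map optionLeafCount).sum := by
    intro l
    induction l with
    | nil => rfl
    | cons o l ih =>
      cases o with
      | none => simp [List.reduceOption_cons_of_none, ih, optionLeafCount_none]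
      | some t => simp [List.reduceOption_cons_of_some, ih, optionLeafCount_some]
  rw [graft, optionLeafCount_graftList, h, List.map_ofFn, List.sum_ofFn]
  rfl

theorem graft_none_left (h : ((2 : ℕ) : ℕ∞) ≤ N) (t : Option (MagTree N X)) :
    graft h ![none, t] = t := by
  cases t <;> rfl

theorem graft_none_right (h : ((2 : ℕ) : ℕ∞) ≤ N) (t : Option (MagTree N X)) :
    graft h ![t, none] = t := by
  cases t <;> rfl

end MagTree

/-! ### The coalgebra structure on `K{X}_N` -/

namespace FreeMag

open MagTree

variable {K : Type u} [Field K] {N : ℕ∞} {X : Type v}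

theorem one_eq_treeBasis : (1 : FreeMag K N X) = treeBasis K N X none := rfl

theorem treePairBasis_apply (s : Option (MagTree N X) × Option (MagTree N X)) :
    treePairBasis K N X s = treeBasis K N X s.1 ⊗ₜ[K] treeBasis K N X s.2 :=
  Module.Basis.tensorProduct_apply' _ _ _

theorem treeBasis_node {k : ℕ} (h2 : 2 ≤ k) (hk : (k : ℕ∞) ≤ N) (c : Fin k → MagTree N X) :
    treeBasis K N X (some (.node k h2 hk c)) = vee hk fun i => treeBasis K N X (some (c i)) := by
  rw [vee_treeBasis, graft_some_of_two_le h2]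

/-- Linear maps out of `K{X}_N` that agree on `1` and on the variables, and which turn the
operations `∨ᵏ` into the same operations, are equal. -/
theorem linearMap_ext {M : Type*} [AddCommGroup M] [Module K M] {φ ψ : FreeMag K N X →ₗ[K] M}
    (h1 : φ 1 = ψ 1) (hvar : ∀ x, φ (var x) = ψ (var x))
    (o : ∀ k : ℕ, (k : ℕ∞) ≤ N → (Fin k → M) → M)
    (hφ : ∀ (k : ℕ) (hk : (k : ℕ∞) ≤ N) a, φ (vee hk a) = o k hk fun i => φ (a i))
    (hψ : ∀ (k : ℕ) (hk : (k : ℕ∞) ≤ N) a, ψ (vee hk a) = o k hk fun i => ψ (a i)) : φ = ψ := by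
  refine (treeBasis K N X).ext fun t => ?_
  cases t with
  | none => exact h1
  | some t =>
    induction t with
    | leaf x => exact hvar x
    | node k h2 hk c ih => rw [treeBasis_node, hφ, hψ, funext ih]

theorem augmentation_one : augmentation K N X 1 = 1 := by
  simp [augmentation, one_eq_treeBasis]

theorem augmentation_some (t : MagTree N X) :
    augmentation K N X (treeBasis K N X (some t)) = 0 := by
  simp [augmentation]

theorem augmentation_var (x : X) : augmentation K N X (var x) = 0 := augmentation_some _

theorem augmentation_treeBasis (t : Option (MagTree N X)) :
    augmentation K N X (treeBasis K N X t) = if optionLeafCount t = 0 then 1 else 0 := by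
  cases t with
  | none => simpa [optionLeafCount_none, one_eq_treeBasis] using augmentation_one (K := K)
  | some t => simpa [optionLeafCount_eq_zero] using augmentation_some t

/-- Leaf counts add under grafting, and a sum of naturals is zero exactly when all its terms are. -/
theorem augmentation_graft {k : ℕ} (hk : (k : ℕ∞) ≤ N) (s : Fin k → Option (MagTree N X)) :
    augmentation K N X (treeBasis K N X (graft hk s)) =
      ∏ i, augmentation K N X (treeBasis K N X (s i)) := by
  simp [augmentation_treeBasis, optionLeafCount_graft, Finset.prod_ite_zero]

theorem augmentation_vee {k : ℕ} (hk : (k : ℕ∞) ≤ N) (a : Fin k → FreeMag K N X) :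
    augmentation K N X (vee hk a) = ∏ i, augmentation K N X (a i) := by
  have h : (augmentation K N X).compMultilinearMap (vee hk) =
      (MultilinearMap.mkPiAlgebra K (Fin k) K).compLinearMap fun _ => augmentation K N X := by
    refine Module.Basis.ext_multilinear (fun _ => treeBasis K N X) fun s => ?_
    simp [vee_treeBasis, augmentation_graft]
  simpa using congrArg (fun f => f a) h

theorem rTensor_augmentation_veeTensor {k : ℕ} (hk : (k : ℕ∞) ≤ N)
    (z : Fin k → FreeMag K N X ⊗[K] FreeMag K N X) :
    TensorProduct.lid K _ ((augmentation K N X).rTensor _ (veeTensor hk z)) =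
      vee hk fun i => TensorProduct.lid K _ ((augmentation K N X).rTensor _ (z i)) := by
  have h : ((TensorProduct.lid K (FreeMag K N X)).toLinearMap ∘ₗ
      (augmentation K N X).rTensor _).compMultilinearMap (veeTensor hk) =
      (vee hk).compLinearMap fun _ => (TensorProduct.lid K (FreeMag K N X)).toLinearMap ∘ₗ
        (augmentation K N X).rTensor _ := by
    refine Module.Basis.ext_multilinear (fun _ => treePairBasis K N X) fun s => ?_
    simp [treePairBasis_apply, veeTensor_tmul, augmentation_vee, MultilinearMap.map_smul_univ]
  simpa using congrArg (fun f => f z) h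

theorem comm_veeTensor {k : ℕ} (hk : (k : ℕ∞) ≤ N)
    (z : Fin k → FreeMag K N X ⊗[K] FreeMag K N X) :
    TensorProduct.comm K _ _ (veeTensor hk z) =
      veeTensor hk fun i => TensorProduct.comm K _ _ (z i) := by
  have h : (TensorProduct.comm K (FreeMag K N X) (FreeMag K N X)).toLinearMap.compMultilinearMap
      (veeTensor hk) = (veeTensor hk).compLinearMap fun _ =>
        (TensorProduct.comm K (FreeMag K N X) (FreeMag K N X)).toLinearMap := by
    refine Module.Basis.ext_multilinear (fun _ => treePairBasis K N X) fun s => ?_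
    simp [treePairBasis_apply, veeTensor_tmul]
  simpa using congrArg (fun f => f z) h

/-- The component-wise operation `∨ᵏ` on `A ⊗ (A ⊗ A)`. -/
noncomputable def veeTensorTensor {k : ℕ} (hk : (k : ℕ∞) ≤ N) :
    MultilinearMap K (fun _ : Fin k => FreeMag K N X ⊗[K] (FreeMag K N X ⊗[K] FreeMag K N X))
      (FreeMag K N X ⊗[K] (FreeMag K N X ⊗[K] FreeMag K N X)) :=
  ((treeBasis K N X).tensorProduct (treePairBasis K N X)).multilinearExt fun s =>
    (graft hk fun i => (s i).1, graft hk fun i => (s i).2.1, graft hk fun i => (s i).2.2)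

theorem veeTensorTensor_tmul {k : ℕ} (hk : (k : ℕ∞) ≤ N) (a : Fin k → FreeMag K N X)
    (z : Fin k → FreeMag K N X ⊗[K] FreeMag K N X) :
    veeTensorTensor hk (fun i => a i ⊗ₜ[K] z i) = vee hk a ⊗ₜ[K] veeTensor hk z :=
  Module.Basis.multilinearExt_tensorProduct_tmul (treeBasis K N X) (treePairBasis K N X)
    (graft hk) (fun s => (graft hk fun i => (s i).1, graft hk fun i => (s i).2)) a z

theorem assoc_veeTensor_tmul_vee {k : ℕ} (hk : (k : ℕ∞) ≤ N)
    (z : Fin k → FreeMag K N X ⊗[K] FreeMag K N X) (a : Fin k → FreeMag K N X) :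
    TensorProduct.assoc K _ _ _ (veeTensor hk z ⊗ₜ[K] vee hk a) =
      veeTensorTensor hk fun i => TensorProduct.assoc K _ _ _ (z i ⊗ₜ[K] a i) := by
  have h : ((TensorProduct.assoc K (FreeMag K N X) (FreeMag K N X) (FreeMag K N X)).toLinearMap ∘ₗ
      (TensorProduct.mk K _ _).flip (vee hk a)).compMultilinearMap (veeTensor hk) =
      (veeTensorTensor hk).compLinearMap fun i =>
        (TensorProduct.assoc K (FreeMag K N X) (FreeMag K N X) (FreeMag K N X)).toLinearMap ∘ₗ
          (TensorProduct.mk K _ _).flip (a i) := by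
    refine Module.Basis.ext_multilinear (fun _ => treePairBasis K N X) fun s => ?_
    simp [treePairBasis_apply, veeTensor_tmul, veeTensorTensor_tmul]
  simpa using congrArg (fun f => f z) h

theorem lTensor_coAdd_veeTensor {k : ℕ} (hk : (k : ℕ∞) ≤ N)
    (z : Fin k → FreeMag K N X ⊗[K] FreeMag K N X) :
    (coAdd K N X).lTensor _ (veeTensor hk z) =
      veeTensorTensor hk fun i => (coAdd K N X).lTensor _ (z i) := by
  have h : ((coAdd K N X).lTensor (FreeMag K N X)).compMultilinearMap (veeTensor hk) =
      (veeTensorTensor hk).compLinearMap fun _ => (coAdd K N X).lTensor (FreeMag K N X) := by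
    refine Module.Basis.ext_multilinear (fun _ => treePairBasis K N X) fun s => ?_
    simp [treePairBasis_apply, veeTensor_tmul, coAdd_vee, veeTensorTensor_tmul]
  simpa using congrArg (fun f => f z) h

theorem assoc_rTensor_coAdd_veeTensor {k : ℕ} (hk : (k : ℕ∞) ≤ N)
    (z : Fin k → FreeMag K N X ⊗[K] FreeMag K N X) :
    TensorProduct.assoc K _ _ _ ((coAdd K N X).rTensor _ (veeTensor hk z)) =
      veeTensorTensor hk fun i =>
        TensorProduct.assoc K _ _ _ ((coAdd K N X).rTensor _ (z i)) := by
  have h : ((TensorProduct.assoc K _ _ _).toLinearMap ∘ₗ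
      (coAdd K N X).rTensor (FreeMag K N X)).compMultilinearMap (veeTensor hk) =
      (veeTensorTensor hk).compLinearMap fun _ => (TensorProduct.assoc K _ _ _).toLinearMap ∘ₗ
        (coAdd K N X).rTensor (FreeMag K N X) := by
    refine Module.Basis.ext_multilinear (fun _ => treePairBasis K N X) fun s => ?_
    simp [treePairBasis_apply, veeTensor_tmul, coAdd_vee, assoc_veeTensor_tmul_vee]
  simpa using congrArg (fun f => f z) h

theorem comm_comp_coAdd :
    (TensorProduct.comm K _ _).toLinearMap ∘ₗ coAdd K N X = coAdd K N X := by
  refine linearMap_ext ?_ (fun x => ?_) (fun k hk => veeTensor hk) (fun k hk a => ?_)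
    fun k hk a => coAdd_vee hk a
  · simp [coAdd_one]
  · simp [coAdd_var, add_comm]
  · simp [coAdd_vee, comm_veeTensor]

theorem rTensor_augmentation_comp_coAdd :
    (augmentation K N X).rTensor _ ∘ₗ coAdd K N X = TensorProduct.mk K K _ 1 := by
  have : (TensorProduct.lid K (FreeMag K N X)).toLinearMap ∘ₗ
      (augmentation K N X).rTensor _ ∘ₗ coAdd K N X = LinearMap.id := by
    refine linearMap_ext ?_ (fun x => ?_) (fun k hk => vee hk) (fun k hk a => ?_)
      fun k hk a => rfl
    · simp [coAdd_one, augmentation_one]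
    · simp [coAdd_var, augmentation_one, augmentation_var]
    · simp [coAdd_vee, rTensor_augmentation_veeTensor]
  ext1 a
  exact (TensorProduct.lid K (FreeMag K N X)).injective
    ((LinearMap.congr_fun this a).trans (by simp))

/-- Both sides intertwine `∨ᵏ` with the component-wise operation on `A ⊗ (A ⊗ A)`, so agreement on
`1` and the variables suffices. -/
theorem coAdd_coassoc :
    (TensorProduct.assoc K _ _ _).toLinearMap ∘ₗ (coAdd K N X).rTensor _ ∘ₗ coAdd K N X =
      (coAdd K N X).lTensor _ ∘ₗ coAdd K N X := by
  refine linearMap_ext ?_ (fun x => ?_) (fun k hk => veeTensorTensor hk) (fun k hk a => ?_)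
    fun k hk a => ?_
  · simp [coAdd_one]
  · simp [coAdd_var, coAdd_one, TensorProduct.add_tmul, TensorProduct.tmul_add, add_assoc]
  · simp [coAdd_vee, assoc_rTensor_coAdd_veeTensor]
  · simp [coAdd_vee, lTensor_coAdd_veeTensor]

noncomputable instance : Coalgebra K (FreeMag K N X) where
  comul := coAdd K N X
  counit := augmentation K N X
  coassoc := coAdd_coassoc
  rTensor_counit_comp_comul := rTensor_augmentation_comp_coAdd
  lTensor_counit_comp_comul := by
    ext a
    have h := LinearMap.congr_fun (rTensor_augmentation_comp_coAdd (K := K) (N := N) (X := X)) a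
    have h2 := LinearMap.congr_fun (comm_comp_coAdd (K := K) (N := N) (X := X)) a
    simp only [LinearMap.comp_apply, LinearEquiv.coe_coe] at h h2 ⊢
    rw [← h2, LinearMap.lTensor_def, TensorProduct.map_comm, ← LinearMap.rTensor_def, h]
    simp

theorem comul_eq_coAdd : Coalgebra.comul (R := K) (A := FreeMag K N X) = coAdd K N X := rfl

theorem counit_eq_augmentation :
    Coalgebra.counit (R := K) (A := FreeMag K N X) = augmentation K N X := rfl

instance : Coalgebra.IsCocomm K (FreeMag K N X) := ⟨comm_comp_coAdd⟩

theorem isGroupLikeElem_one : IsGroupLikeElem K (1 : FreeMag K N X) :=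
  ⟨augmentation_one, coAdd_one⟩

/-- The binary operation `∨²` as a morphism of coalgebras. -/
noncomputable def veeTwo (h : ((2 : ℕ) : ℕ∞) ≤ N) :
    FreeMag K N X ⊗[K] FreeMag K N X →ₗc[K] FreeMag K N X where
  toLinearMap := TensorProduct.lift (vee h).toBilin
  counit_comp := by
    refine TensorProduct.ext' fun a b => ?_
    simp [MultilinearMap.toBilin_apply, counit_eq_augmentation, augmentation_vee, mul_comm]
  map_comp_comul := by
    -- The component-wise `∨²` on `A ⊗ A` is `μ ⊗ μ` after exchanging the middle factors;
    -- `coAdd_vee` then becomes compatibility of `μ` with comultiplication.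
    have h1 : TensorProduct.lift (veeTensor h).toBilin =
        TensorProduct.map (TensorProduct.lift (vee h).toBilin)
          (TensorProduct.lift (vee h).toBilin) ∘ₗ (TensorProduct.tensorTensorTensorComm K
            (FreeMag K N X) (FreeMag K N X) (FreeMag K N X) (FreeMag K N X)).toLinearMap := by
      refine TensorProduct.ext_fourfold' fun a b c d => ?_
      have h2 := veeTensor_tmul h ![a, c] ![b, d]
      have h3 : (fun i => ![a, c] i ⊗ₜ[K] ![b, d] i) = ![a ⊗ₜ[K] b, c ⊗ₜ[K] d] := by
        funext i; fin_cases i <;> rfl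
      rw [h3] at h2
      simpa [MultilinearMap.toBilin_apply] using h2
    refine TensorProduct.ext' fun a b => ?_
    have h4 := LinearMap.congr_fun h1 (coAdd K N X a ⊗ₜ coAdd K N X b)
    have h5 : (fun i => coAdd K N X (![a, b] i)) = ![coAdd K N X a, coAdd K N X b] := by
      funext i; fin_cases i <;> rfl
    refine h4.symm.trans ?_
    simp [MultilinearMap.toBilin_apply, comul_eq_coAdd, coAdd_vee, h5]

theorem veeTwo_one_tmul (h : ((2 : ℕ) : ℕ∞) ≤ N) (a : FreeMag K N X) :
    veeTwo h (1 ⊗ₜ[K] a) = a := by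
  have : (vee (K := K) (X := X) h).toBilin 1 = LinearMap.id := by
    refine (treeBasis K N X).ext fun t => ?_
    have h1 : ![(1 : FreeMag K N X), treeBasis K N X t] = fun i => treeBasis K N X (![none, t] i) := by
      funext i; fin_cases i <;> rfl
    rw [MultilinearMap.toBilin_apply, h1, vee_treeBasis, graft_none_left, LinearMap.id_apply]
  exact LinearMap.congr_fun this a

theorem veeTwo_tmul_one (h : ((2 : ℕ) : ℕ∞) ≤ N) (a : FreeMag K N X) :
    veeTwo h (a ⊗ₜ[K] 1) = a := by
  have : (vee (K := K) (X := X) h).toBilin.flip 1 = LinearMap.id := by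
    refine (treeBasis K N X).ext fun t => ?_
    have h1 : ![treeBasis K N X t, (1 : FreeMag K N X)] = fun i => treeBasis K N X (![t, none] i) := by
      funext i; fin_cases i <;> rfl
    rw [LinearMap.flip_apply, MultilinearMap.toBilin_apply, h1, vee_treeBasis, graft_none_right,
      LinearMap.id_apply]
  exact LinearMap.congr_fun this a

/-! ### Conilpotence from the leaf grading -/

variable (K N X) in
/-- The homogeneous component of degree `n` of `A ⊗ A`, with respect to the number of leaves. -/
noncomputable def tensorDegree (n : ℕ) : Submodule K (FreeMag K N X ⊗[K] FreeMag K N X) :=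
  Submodule.span K (treePairBasis K N X ''
    {s | optionLeafCount s.1 + optionLeafCount s.2 = n})

theorem tmul_mem_tensorDegree (s t : Option (MagTree N X)) :
    treeBasis K N X s ⊗ₜ[K] treeBasis K N X t ∈
      tensorDegree K N X (optionLeafCount s + optionLeafCount t) :=
  Submodule.subset_span ⟨(s, t), rfl, treePairBasis_apply _⟩

theorem veeTensor_mem_tensorDegree {k : ℕ} (hk : (k : ℕ∞) ≤ N) (n : Fin k → ℕ)
    (z : Fin k → FreeMag K N X ⊗[K] FreeMag K N X) (hz : ∀ i, z i ∈ tensorDegree K N X (n i)) :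
    veeTensor hk z ∈ tensorDegree K N X (∑ i, n i) := by
  classical
  have hz' : z = fun i => ∑ s ∈ ((treePairBasis K N X).repr (z i)).support,
      (treePairBasis K N X).repr (z i) s • treePairBasis K N X s := by
    funext i
    conv_lhs => rw [← (treePairBasis K N X).linearCombination_repr (z i)]
    rfl
  rw [hz', MultilinearMap.map_sum_finset]
  refine Submodule.sum_mem _ fun r hr => ?_
  rw [MultilinearMap.map_smul_univ]
  refine Submodule.smul_mem _ _ ?_
  have hr' : ∀ i, optionLeafCount (r i).1 + optionLeafCount (r i).2 = n i := fun i =>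
    ((treePairBasis K N X).mem_span_image.1 (hz i)) (Fintype.mem_piFinset.1 hr i)
  simp only [treePairBasis_apply]
  rw [veeTensor_treeBasis]
  have h := tmul_mem_tensorDegree (K := K) (graft hk fun i => (r i).1) (graft hk fun i => (r i).2)
  rwa [optionLeafCount_graft, optionLeafCount_graft, ← Finset.sum_add_distrib,
    Finset.sum_congr rfl fun i _ => hr' i] at h

theorem coAdd_mem_tensorDegree (t : Option (MagTree N X)) :
    coAdd K N X (treeBasis K N X t) ∈ tensorDegree K N X (optionLeafCount t) := by
  cases t with
  | none => exact coAdd_one (K := K) (N := N) (X := X) ▸ tmul_mem_tensorDegree none none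
  | some t =>
    induction t with
    | leaf x =>
      have h := coAdd_var (K := K) (N := N) x
      rw [var] at h
      rw [h]
      exact add_mem (tmul_mem_tensorDegree (some (.leaf x)) none)
        (by simpa [optionLeafCount, one_eq_treeBasis] using tmul_mem_tensorDegree (K := K) none (some (.leaf x)))
    | node k h2 hk c ih =>
      rw [treeBasis_node, coAdd_vee]
      exact veeTensor_mem_tensorDegree hk _ _ ih

/-- In `Δ'` of a tree the right factor can be taken nonempty, so the left factor loses leaves. The
index `n + 1` accommodates the empty tree, which the `0`-th iterate (an isomorphism) does not kill.
-/
theorem iteratedReducedComul_treeBasis (n : ℕ) (t : Option (MagTree N X))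
    (ht : optionLeafCount t ≤ n) :
    iteratedReducedComul K (1 : FreeMag K N X) (n + 1) (treeBasis K N X t) = 0 := by
  have hone : ∀ n, iteratedReducedComul K (1 : FreeMag K N X) (n + 1) 1 = 0 := fun n => by
    rw [iteratedReducedComul_succ_eq_zero]
    simp [reducedComul, augProj_self isGroupLikeElem_one]
  induction n generalizing t with
  | zero =>
    rw [optionLeafCount_eq_zero.1 (Nat.le_zero.1 ht)]
    exact hone 0
  | succ n ih =>
    cases t with
    | none => exact hone _
    | some t =>
      rw [iteratedReducedComul_succ_eq_zero]
      set a := treeBasis K N X (some t) with ha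
      set q := iteratedReducedComul K (1 : FreeMag K N X) (n + 1) with hq
      -- The projection kills an empty right tree; a nonempty one leaves at most `n` leaves on the
      -- left, where `q` vanishes by induction.
      have h1 : ∀ d ≤ n + 1, ∀ z ∈ tensorDegree K N X d,
          TensorProduct.map q (augProj K (1 : FreeMag K N X)) z = 0 := by
        intro d hd z hz
        refine Submodule.span_induction (p := fun z _ =>
          TensorProduct.map q (augProj K (1 : FreeMag K N X)) z = 0) ?_ (map_zero _)
          (fun x y _ _ hx hy => by rw [map_add, hx, hy, add_zero])
          (fun r x _ hx => by rw [map_smul, hx, smul_zero]) hz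
        rintro _ ⟨⟨s, s'⟩, hs, rfl⟩
        rw [treePairBasis_apply, TensorProduct.map_tmul]
        cases s' with
        | none =>
          have := augProj_self (K := K) (isGroupLikeElem_one (K := K) (N := N) (X := X))
          rw [one_eq_treeBasis] at this
          rw [one_eq_treeBasis, this, TensorProduct.tmul_zero]
        | some s' =>
          have h2 := s'.leafCount_pos
          simp only [Set.mem_ofPred_eq, optionLeafCount_some] at hs
          rw [ih s (by omega), TensorProduct.zero_tmul]
      have h2 : Coalgebra.counit (R := K) a = 0 := augmentation_some t
      -- Projecting the right factor removes `a ⊗ 1`; the remaining correction `1 ⊗ a` is killed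
      -- because `q 1 = 0`.
      have h3 : reducedComul K (1 : FreeMag K N X) a =
          (augProj K (1 : FreeMag K N X)).lTensor _ (Coalgebra.comul (R := K) a) - 1 ⊗ₜ a := by
        have h4 : (augProj K (1 : FreeMag K N X)).lTensor (FreeMag K N X) = LinearMap.id -
            TensorProduct.map LinearMap.id (LinearMap.toSpanSingleton K (FreeMag K N X) 1) ∘ₗ
              (Coalgebra.counit (R := K) (A := FreeMag K N X)).lTensor (FreeMag K N X) := by
          refine TensorProduct.ext' fun x y => ?_
          simp [augProj_apply, TensorProduct.tmul_sub]
        rw [h4, LinearMap.sub_apply, LinearMap.comp_apply, Coalgebra.lTensor_counit_comul]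
        simp [reducedComul, augProj_of_counit_eq_zero h2]
      have h5 := h1 _ ht _ (coAdd_mem_tensorDegree (some t))
      rw [h3, map_sub, ← LinearMap.comp_apply, LinearMap.rTensor_comp_lTensor]
      rw [comul_eq_coAdd, h5, LinearMap.rTensor_tmul, hq, hone, TensorProduct.zero_tmul, sub_zero]

theorem isConilpotent_one : IsConilpotent K (1 : FreeMag K N X) := by
  intro c _
  refine ⟨((treeBasis K N X).repr c).support.sup optionLeafCount + 1, ?_⟩
  have h : iteratedReducedComul K (1 : FreeMag K N X)
      (((treeBasis K N X).repr c).support.sup optionLeafCount + 1)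
      (Finsupp.linearCombination K (treeBasis K N X) ((treeBasis K N X).repr c)) = 0 := by
    rw [Finsupp.linearCombination_apply, Finsupp.sum, map_sum]
    refine Finset.sum_eq_zero fun t ht => ?_
    rw [map_smul, iteratedReducedComul_treeBasis _ _ (Finset.le_sup ht), smul_zero]
  rwa [(treeBasis K N X).linearCombination_repr] at h

end FreeMag

/-! ### Projections onto primitives and the theorem -/

/-- There is a projection onto the primitive elements of a coaugmented coalgebra that vanishes on
the coaugmentation. -/
theorem exists_projection_primitiveElements {K : Type u} [Field K] {C : Type v} [AddCommGroup C]
    [Module K C] [Coalgebra K C] {e : C} (he : IsGroupLikeElem K e) :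
    ∃ p : C →ₗ[K] primitiveElements K e, p e = 0 ∧ ∀ c : primitiveElements K e, p c = c := by
  obtain ⟨q, hq⟩ := (primitiveElements K e).subtype.exists_leftInverse_of_injective
    (Submodule.ker_subtype _)
  -- Precomposing with `augProj` forces vanishing at `e`; primitives are unaffected because their
  -- counit is zero.
  refine ⟨q ∘ₗ augProj K e, by simp [augProj_self he], fun c => ?_⟩
  rw [LinearMap.comp_apply,
    augProj_of_counit_eq_zero (counit_eq_zero_of_mem_primitiveElements he c.2)]
  exact LinearMap.congr_fun hq c

theorem theorem5p5 {K : Type u} [Field K] [CharZero K] (N : ℕ∞) (hN : 2 ≤ N) (X : Type v) :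
    ∃ S : Coalgebra K (FreeMag K N X),
      S.comul = FreeMag.coAdd K N X ∧
      S.counit = FreeMag.augmentation K N X ∧
      IsGroupLikeElem K (1 : FreeMag K N X) ∧
      Coalgebra.IsCocomm K (FreeMag K N X) ∧
      IsConilpotent K (1 : FreeMag K N X) ∧
      (∃ p : FreeMag K N X →ₗ[K] primitiveElements K (1 : FreeMag K N X),
        p 1 = 0 ∧ ∀ c : primitiveElements K (1 : FreeMag K N X), p c = c) ∧
      ∀ p : FreeMag K N X →ₗ[K] primitiveElements K (1 : FreeMag K N X),
        p 1 = 0 → (∀ c : primitiveElements K (1 : FreeMag K N X), p c = c) →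
          IsCofreeCocommutative.{u, max u v, w} K (1 : FreeMag K N X) p :=
  ⟨inferInstance, rfl, rfl, FreeMag.isGroupLikeElem_one, inferInstance, FreeMag.isConilpotent_one,
    exists_projection_primitiveElements FreeMag.isGroupLikeElem_one,
    isCofreeCocommutative_of_unital_mul FreeMag.isGroupLikeElem_one
      (FreeMag.veeTwo (by exact_mod_cast hN)) (FreeMag.veeTwo_one_tmul _)
      (FreeMag.veeTwo_tmul_one _)⟩
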